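/- **Theorem 1.1.** Let $d\ge 1$, $1\le p<\infty$, and let $\nu:\mathbb R^d\setminus\{0\}\to[0,\infty]$ be measurable. Write $c_d=|B(0,1)|$ and $\eta(r)=(r/c_d)^{1/d}$, and define $w:[0,\infty]\to[0,\infty]$ by $$w(r)=\Big(|B(0,\eta(r))|\int_{B(0,\eta(r))^c}\nu(h)\,dh\Big)^{1/p}\quad(0<r<\infty),\qquad w(0)=0,\quad w(\infty)=\infty .$$ A *Young function* is a convex function $\psi:[0,\infty]\to[0,\infty]$ with $\psi(0)=0$. Assume: * **(A)** $\int_{\mathbb R^d}(1\wedge|h|^p)\,\nu(h)\,dh<\infty$, $\nu$ is radial, and there is $0<\kappa\le1$ with $\kappa\,\nu(x)\le\nu(y)$ whenever $|x|\ge|y|>0$. * **(B)** The map $t\mapsto 1/w(1/t)$ is a bijection of $[0,\infty]$ onto itself, and its inverse $\phi$ is a Young function. * **(C)** $\phi_p(t)=\phi(t^{1/p})$ is a Young function and there is $\theta>0$ with $\phi_p\big(\theta^p\frac st\big)\le\frac{\phi_p(s)}{\phi_p(t)}$ for all $0\le s\le t$, $0<t<\infty$. Let $|u|_{W^p_\nu}=\big(\iint_{\mathbb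 R^d\times\mathbb R^d}|u(x)-u(y)|^p\nu(x-y)\,dy\,dx\big)^{1/p}$, let $W^p_\nu(\mathbb R^d)=\{u\in L^p(\mathbb R^d):|u|_{W^p_\nu}<\infty\}$ with norm $(\|u\|_{L^p}^p+|u|_{W^p_\nu}^p)^{1/p}$, and let $W^{1,p}(\mathbb R^d)$ be the space of $u\in L^p(\mathbb R^d)$ whose distributional gradient lies in $L^p$, with norm $(\|u\|_{L^p}^p+\|\nabla u\|_{L^p}^p)^{1/p}$. Let $L^\phi(\mathbb R^d)$ be the Orlicz space of measurable $u:\mathbb R^d\to\mathbb R$ with $\int_{\mathbb R^d}\phi(|u|/\lambda)\,dx<\infty$ for some $\lambda>0$, with the Luxemburg norm $\|u\|_{L^\phi}=\inf\{\lambda>0:\int_{\mathbb R^d}\phi(|u|/\lambda)\,dx\le1\}$. Then for every real $t\ge2$ and every $u\in L^\phi(\mathbb R^d)$, $$\|u\|_{L^\phi(\mathbb R^d)}\le\Theta_t\,|u|_{W^p_\nu},\qquad \Theta_t=t\Big[2\kappa^2C_p(t)\,\phi\big(\tfrac{\theta}{t}\big)\Big]^{-1/p},\qquad C_p(t)=\frac{t^p-2}{t^p-1},$$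 where $\Theta_t=\infty$ if $C_p(t)=0$ (that is, if $p=1$ and $t=2$), with the convention $\infty\cdot 0=0$. Moreover the embeddings $W^p_\nu(\mathbb R^d)\hookrightarrow L^\phi(\mathbb R^d)$ and $W^{1,p}(\mathbb R^d)\hookrightarrow L^\phi(\mathbb R^d)$ are continuous: each space is contained in $L^\phi(\mathbb R^d)$, and $\|u\|_{L^\phi}$ is bounded by a constant, independent of $u$, times the norm of $u$ in that space. -/

import Mathlib

open MeasureTheory Set
open scoped ENNReal NNReal

noncomputable section

namespace NonlocalSobolev

/-- The Euclidean space `ℝ^d`. -/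
abbrev E (d : ℕ) : Type := EuclideanSpace ℝ (Fin d)

/-! ### Young functions and Orlicz spaces -/

/-- A Young function: a convex function `[0,∞] → [0,∞]` vanishing at `0`. -/
structure IsYoung (φ : ℝ≥0∞ → ℝ≥0∞) : Prop where
  convex : ConvexOn ℝ≥0 univ φ
  map_zero : φ 0 = 0

/-- The modular `∫ φ(|u(x)| / l) dx`. -/
def modular {d : ℕ} (φ : ℝ≥0∞ → ℝ≥0∞) (u : E d → ℝ) (l : ℝ≥0) : ℝ≥0∞ :=
  ∫⁻ x, φ (‖u x‖ₑ / (l : ℝ≥0∞))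

/-- The Orlicz space `L^φ(ℝ^d)`, as a set of (Lebesgue measurable) functions. -/
def orliczSpace (d : ℕ) (φ : ℝ≥0∞ → ℝ≥0∞) : Set (E d → ℝ) :=
  {u | AEStronglyMeasurable u volume ∧ ∃ l : ℝ≥0, 0 < l ∧ modular φ u l < ∞}

/-- The Luxemburg norm `inf {l > 0 : ∫ φ(|u| / l) ≤ 1}`, with values in `[0,∞]`. -/
def luxemburgNorm {d : ℕ} (φ : ℝ≥0∞ → ℝ≥0∞) (u : E d → ℝ) : ℝ≥0∞ :=
  ⨅ (l : ℝ≥0) (_ : 0 < l) (_ : modular φ u l ≤ 1), (l : ℝ≥0∞)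

/-! ### The nonlocal Sobolev space `W^p_ν`

The value of the kernel `ν` at `0` is irrelevant to all definitions below. -/

/-- The seminorm `(∬ |u(x) - u(y)|^p ν(x - y) dy dx)^(1/p)`, with values in `[0,∞]`. -/
def nonlocalSeminorm {d : ℕ} (ν : E d → ℝ≥0∞) (p : ℝ) (u : E d → ℝ) : ℝ≥0∞ :=
  (∫⁻ x, ∫⁻ y, ‖u x - u y‖ₑ ^ p * ν (x - y)) ^ (1 / p)

/-- `W^p_ν(ℝ^d)`: functions in `L^p(ℝ^d)` with finite nonlocal seminorm. -/
def nonlocalSpace {d : ℕ} (ν : E d → ℝ≥0∞) (p : ℝ) : Set (E d → ℝ) :=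
  {u | MemLp u (ENNReal.ofReal p) volume ∧ nonlocalSeminorm ν p u < ∞}

/-- The norm `(‖u‖_{L^p}^p + |u|_{W^p_ν}^p)^(1/p)`. -/
def nonlocalNorm {d : ℕ} (ν : E d → ℝ≥0∞) (p : ℝ) (u : E d → ℝ) : ℝ≥0∞ :=
  (eLpNorm u (ENNReal.ofReal p) volume ^ p + nonlocalSeminorm ν p u ^ p) ^ (1 / p)

/-! ### The classical Sobolev space `W^{1,p}` -/

/-- `g` is the distributional gradient of `u`. -/
structure IsWeakGradient {d : ℕ} (u : E d → ℝ) (g : E d → E d) : Prop where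
  locallyIntegrable : LocallyIntegrable u volume
  locallyIntegrable_grad : LocallyIntegrable g volume
  integral_eq : ∀ ψ : E d → ℝ, ContDiff ℝ ((⊤ : ℕ∞) : WithTop ℕ∞) ψ → HasCompactSupport ψ → ∀ v : E d,
    ∫ x, u x * fderiv ℝ ψ x v = -∫ x, inner ℝ (g x) v * ψ x

/-- `W^{1,p}(ℝ^d)`: functions in `L^p(ℝ^d)` with distributional gradient in `L^p`. -/
def sobolevSpace (d : ℕ) (p : ℝ) : Set (E d → ℝ) :=
  {u | MemLp u (ENNReal.ofReal p) volume ∧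
    ∃ g : E d → E d, IsWeakGradient u g ∧ MemLp g (ENNReal.ofReal p) volume}

/-- `‖∇u‖_{L^p}` for the distributional gradient. The latter is unique up to null sets, so that
the infimum runs over copies of a single number; it is `∞` if there is no locally integrable
distributional gradient. -/
def gradNorm {d : ℕ} (p : ℝ) (u : E d → ℝ) : ℝ≥0∞ :=
  ⨅ (g : E d → E d) (_ : IsWeakGradient u g), eLpNorm g (ENNReal.ofReal p) volume

/-- The norm `(‖u‖_{L^p}^p + ‖∇u‖_{L^p}^p)^(1/p)`. -/
def sobolevNorm {d : ℕ} (p : ℝ) (u : E d → ℝ) : ℝ≥0∞ :=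
  (eLpNorm u (ENNReal.ofReal p) volume ^ p + gradNorm p u ^ p) ^ (1 / p)

/-- Continuous embedding `X ↪ Y` of function spaces `X`, `Y` with norms `nX`, `nY`. -/
def ContinuouslyEmbeds {d : ℕ} (X : Set (E d → ℝ)) (nX : (E d → ℝ) → ℝ≥0∞)
    (Y : Set (E d → ℝ)) (nY : (E d → ℝ) → ℝ≥0∞) : Prop :=
  X ⊆ Y ∧ ∃ C : ℝ≥0, ∀ u ∈ X, nY u ≤ C * nX u

/-! ### Assumptions on the kernel -/

/-- A radial, almost decreasing, `p`-Lévy integrable kernel, with constant `κ`. -/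
structure IsAlmostDecreasingLevyKernel {d : ℕ} (ν : E d → ℝ≥0∞) (p κ : ℝ) : Prop where
  measurable : Measurable ν
  levy : ∫⁻ h, min 1 (‖h‖ₑ ^ p) * ν h < ∞
  radial : ∀ x y : E d, ‖x‖ = ‖y‖ → ν x = ν y
  kappa_pos : 0 < κ
  kappa_le_one : κ ≤ 1
  almost_decreasing : ∀ x y : E d, y ≠ 0 → ‖y‖ ≤ ‖x‖ → ENNReal.ofReal κ * ν x ≤ ν y

/-- The radius `η(r) = (r / c_d)^(1/d)`, `c_d = |B(0,1)|`, of the ball of volume `r`. -/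
def ballRadius (d : ℕ) (r : ℝ≥0∞) : ℝ :=
  (r.toReal / (volume (Metric.ball (0 : E d) 1)).toReal) ^ (1 / (d : ℝ))

/-- `w(r) = (|B(0,η(r))| ∫_{B(0,η(r))ᶜ} ν)^(1/p)` for `0 ≤ r < ∞` (so that `w(0) = 0`), and
`w(∞) = ∞`. -/
def wFun {d : ℕ} (ν : E d → ℝ≥0∞) (p : ℝ) (r : ℝ≥0∞) : ℝ≥0∞ :=
  if r = ∞ then ∞
  else (volume (Metric.ball (0 : E d) (ballRadius d r)) *
    ∫⁻ h in (Metric.ball (0 : E d) (ballRadius d r))ᶜ, ν h) ^ (1 / p)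

/-- The map `t ↦ 1 / w(1/t)` of `[0,∞]` to itself. -/
def recipW {d : ℕ} (ν : E d → ℝ≥0∞) (p : ℝ) (t : ℝ≥0∞) : ℝ≥0∞ := (wFun ν p t⁻¹)⁻¹

/-- The critical function `φ`: the inverse of `t ↦ 1 / w(1/t)`. It is meaningful when that map
is bijective. -/
def criticalFun {d : ℕ} (ν : E d → ℝ≥0∞) (p : ℝ) : ℝ≥0∞ → ℝ≥0∞ :=
  Function.invFun (recipW ν p)

/-- The map `t ↦ 1 / w(1/t)` is invertible, and its inverse is a Young function. -/
structure HasCriticalYoung {d : ℕ} (ν : E d → ℝ≥0∞) (p : ℝ) : Prop where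
  bijective : Function.Bijective (recipW ν p)
  young : IsYoung (criticalFun ν p)

/-- `φ_p(t) = φ(t^(1/p))`. -/
def powComp (φ : ℝ≥0∞ → ℝ≥0∞) (p : ℝ) (t : ℝ≥0∞) : ℝ≥0∞ := φ (t ^ (1 / p))

/-- `φ_p` is a Young function and `φ_p(θ^p s/t) ≤ φ_p(s)/φ_p(t)` for `s ≤ t`. -/
structure GrowthCondition (φ : ℝ≥0∞ → ℝ≥0∞) (p θ : ℝ) : Prop where
  young : IsYoung (powComp φ p)
  theta_pos : 0 < θ
  growth : ∀ s t : ℝ≥0∞, t ≠ 0 → t ≠ ∞ → s ≤ t →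
    powComp φ p (ENNReal.ofReal θ ^ p * (s / t)) ≤ powComp φ p s / powComp φ p t

/-- `Θ_t = t [2 κ² C_p(t) φ(θ/t)]^(-1/p)` with `C_p(t) = (t^p - 2)/(t^p - 1)`. It is computed in
`[0,∞]`, so that `Θ_t = ∞` if `C_p(t) = 0`, which for `t ≥ 2` means `p = 1` and `t = 2`. -/
def Theta (φ : ℝ≥0∞ → ℝ≥0∞) (p κ θ t : ℝ) : ℝ≥0∞ :=
  ENNReal.ofReal t *
    (ENNReal.ofReal (2 * κ ^ 2 * ((t ^ p - 2) / (t ^ p - 1))) *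
      φ (ENNReal.ofReal (θ / t))) ^ (-(1 / p))

end NonlocalSobolev

end

open NonlocalSobolev

namespace NonlocalSobolev

open Filter Topology

/-! Write `T` for the tail mass of `ν` outside the ball of given volume, `F a = a * T a`, `ψ = φ_p`,
`r = 1/t`, `q = r^p`. The definition of `φ` amounts to `ψ (1 / F a) = 1 / a`.

For `0 ≤ v ≤ M`, let `a k` be the measure of `{v > M r^k}`; thus `a 0 = 0` and `a` increases. Three
estimates are chained. (1) Among sets of given volume a centred ball nearly minimises the `ν`-mass
of the complement, and pairs of points separated by two consecutive levels contribute to the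
seminorm; hence `2κ(1-q) M^p ∑ q^(k+1) a k T(a (k+1))` is at most its `p`-th power (`tailMass_le`,
`level_sum_le`). (2) The growth condition bounds `ψ(θ^p F(a k) / F(a (k+1)))` by `a k / a (k+1)`.
Jensen with weights `q^(k+1) F(a (k+1))`, under which the ratios `F(a k) / F(a (k+1))` have mean
`q`, gives `ψ(θ^p q) S ≤ ∑ q^(k+1) a k T(a (k+1))` with `S = ∑ q^(k+1) F(a (k+1))`
(`powComp_mul_tsum_le`). (3) If `M^p S ≤ q l^p`, summing over the layers between levels bounds the
modular at `l` by `1` (`HasCriticalYoung.modular_le_one`).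

Truncation and Fatou extend this to every `u` whose superlevel sets at positive heights have finite
measure, which holds in `L^φ` and in `L^p`. For `W^{1,p}`, the bound of `‖u(· + h) - u‖_p` by `|h|
‖∇u‖_p` and by `2 ‖u‖_p`, integrated against `ν`, gives an embedding into `W^p_ν`. -/

/-! ### Young functions: scaling, monotonicity, supporting lines. -/

theorem IsYoung.map_mul_le {φ : ℝ≥0∞ → ℝ≥0∞} (h : IsYoung φ) {c : ℝ≥0∞} (hc : c ≤ 1) (x : ℝ≥0∞) :
    φ (c * x) ≤ c * φ x := by
  lift c to ℝ≥0 using ne_top_of_le_ne_top ENNReal.one_ne_top hc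
  have hc' : c ≤ 1 := by exact_mod_cast hc
  have := h.convex.2 (mem_univ x) (mem_univ 0) (zero_le (a := c)) (zero_le (a := 1 - c))
    (add_tsub_cancel_of_le hc')
  simpa [ENNReal.smul_def, h.map_zero] using this

/-- The value at `∞` has to be assumed: convexity on `[0,∞]` allows a drop there, as for the
identity on finite values with `φ ∞ = 0`. -/
theorem IsYoung.monotone {φ : ℝ≥0∞ → ℝ≥0∞} (h : IsYoung φ) (ht : φ ∞ = ∞) : Monotone φ := by
  intro x y hxy
  rcases eq_or_ne y ∞ with rfl | hy
  · simp [ht]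
  rcases eq_or_ne y 0 with rfl | hy0
  · rw [nonpos_iff_eq_zero.1 hxy]
  have h1 : x / y ≤ 1 := ENNReal.div_le_of_le_mul (by simpa using hxy)
  calc φ x = φ (x / y * y) := by rw [ENNReal.div_mul_cancel hy0 hy]
    _ ≤ x / y * φ y := h.map_mul_le h1 y
    _ ≤ 1 * φ y := by gcongr
    _ = φ y := one_mul _

/-- A finite-valued Young function has a subgradient at every positive point. -/
theorem IsYoung.exists_subgradient {ψ : ℝ≥0∞ → ℝ≥0∞} (h : IsYoung ψ) (ht : ψ ∞ = ∞)
    (hfin : ∀ x, x ≠ ∞ → ψ x ≠ ∞) {a : ℝ≥0∞} (ha0 : a ≠ 0) (ha : a ≠ ∞) :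
    ∃ m : ℝ≥0∞, m ≠ ∞ ∧ ∀ x, x ≠ ∞ → ψ a + m * x ≤ ψ x + m * a := by
  set f : ℝ → ℝ := fun x => (ψ (ENNReal.ofReal x)).toReal with hf
  have hmono := h.monotone ht
  have hconv : ConvexOn ℝ (Ici 0) f := by
    refine ⟨convex_Ici 0, fun x hx y hy α β hα hβ hαβ => ?_⟩
    have hx : 0 ≤ x := hx
    have hy : 0 ≤ y := hy
    have key := h.convex.2 (mem_univ (ENNReal.ofReal x)) (mem_univ (ENNReal.ofReal y))
      (zero_le (a := α.toNNReal)) (zero_le (a := β.toNNReal))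
      (by rw [← Real.toNNReal_add hα hβ, hαβ, Real.toNNReal_one])
    simp only [ENNReal.smul_def, smul_eq_mul] at key
    change ψ (ENNReal.ofReal α * ENNReal.ofReal x + ENNReal.ofReal β * ENNReal.ofReal y) ≤
      ENNReal.ofReal α * ψ (ENNReal.ofReal x) + ENNReal.ofReal β * ψ (ENNReal.ofReal y) at key
    rw [← ENNReal.ofReal_mul hα, ← ENNReal.ofReal_mul hβ,
      ← ENNReal.ofReal_add (by positivity) (by positivity)] at key
    have h1 := hfin _ (ENNReal.ofReal_ne_top (r := x))
    have h2 := hfin _ (ENNReal.ofReal_ne_top (r := y))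
    have := ENNReal.toReal_mono (by finiteness) key
    rw [ENNReal.toReal_add (by finiteness) (by finiteness), ENNReal.toReal_mul,
      ENNReal.toReal_mul, ENNReal.toReal_ofReal hα, ENNReal.toReal_ofReal hβ] at this
    simpa [hf] using this
  have hapos : 0 < a.toReal := ENNReal.toReal_pos ha0 ha
  obtain ⟨m, hm0, hm⟩ : ∃ m : ℝ, 0 ≤ m ∧ ∀ x, 0 ≤ x → f a.toReal + m * x ≤ f x + m * a.toReal := by
    have hint : a.toReal ∈ interior (Ici (0 : ℝ)) := by simpa using hapos
    have hright : ∀ x, 0 ≤ x → x < a.toReal →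
        (f a.toReal - f x) / (a.toReal - x) ≤ derivWithin f (Ioi a.toReal) a.toReal := by
      intro x hx hxa
      have := (hconv.slope_le_leftDeriv_of_mem_interior hx hint hxa).trans
        (hconv.leftDeriv_le_rightDeriv_of_mem_interior hint)
      rwa [slope_def_field] at this
    -- The supporting slope is the right derivative at `a`; it is nonnegative because it dominates
    -- the slope of the chord from `0`, where `f` vanishes.
    refine ⟨derivWithin f (Ioi a.toReal) a.toReal, ?_, fun x hx => ?_⟩
    · refine le_trans ?_ (hright 0 le_rfl hapos)
      have : f 0 = 0 := by simp [hf, h.map_zero]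
      rw [this]
      have : 0 ≤ f a.toReal := ENNReal.toReal_nonneg
      simp only [sub_zero]
      positivity
    · rcases lt_trichotomy x a.toReal with hxa | rfl | hxa
      · have := hright x hx hxa
        rw [div_le_iff₀ (by linarith)] at this
        linarith
      · exact le_rfl
      · have := hconv.rightDeriv_le_slope_of_mem_interior hint hx hxa
        rw [slope_def_field, le_div_iff₀ (by linarith)] at this
        linarith
  refine ⟨ENNReal.ofReal m, ENNReal.ofReal_ne_top, fun x hx => ?_⟩
  have := hm x.toReal ENNReal.toReal_nonneg
  simp only [hf, ENNReal.ofReal_toReal ha, ENNReal.ofReal_toReal hx] at this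
  have h2 := ENNReal.ofReal_le_ofReal this
  rwa [ENNReal.ofReal_add (by positivity) (by positivity),
    ENNReal.ofReal_add (by positivity) (by positivity), ENNReal.ofReal_mul hm0,
    ENNReal.ofReal_mul hm0, ENNReal.ofReal_toReal hx, ENNReal.ofReal_toReal ha,
    ENNReal.ofReal_toReal (hfin _ hx), ENNReal.ofReal_toReal (hfin _ ha)] at h2

/-! ### The critical function and the tail mass of the kernel. -/

section Critical

variable {d : ℕ} {ν : E d → ℝ≥0∞} {p : ℝ}

theorem HasCriticalYoung.criticalFun_recipW (h : HasCriticalYoung ν p) (t : ℝ≥0∞) :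
    criticalFun ν p (recipW ν p t) = t :=
  Function.leftInverse_invFun h.bijective.1 t

theorem HasCriticalYoung.criticalFun_bijective (h : HasCriticalYoung ν p) :
    Function.Bijective (criticalFun ν p) := by
  have h2 := Function.rightInverse_invFun h.bijective.2
  exact ⟨h2.injective, (Function.leftInverse_invFun h.bijective.1).surjective⟩

theorem volume_ball_ballRadius (hd : 1 ≤ d) {r : ℝ≥0∞} (hr : r ≠ ∞) :
    volume (Metric.ball (0 : E d) (ballRadius d r)) = r := by
  have : Nonempty (Fin d) := ⟨⟨0, hd⟩⟩
  have hc : 0 < (volume (Metric.ball (0 : E d) 1)).toReal :=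
    ENNReal.toReal_pos (Metric.measure_ball_pos _ _ one_pos).ne' measure_ball_lt_top.ne
  have hd' : (d : ℝ) ≠ 0 := by positivity
  rw [Measure.addHaar_ball _ _ (by unfold ballRadius; positivity)]
  simp only [ballRadius, finrank_euclideanSpace, Fintype.card_fin]
  rw [← Real.rpow_natCast, ← Real.rpow_mul (by positivity), one_div_mul_cancel hd', Real.rpow_one,
    ENNReal.ofReal_div_of_pos hc, ENNReal.ofReal_toReal hr,
    ENNReal.ofReal_toReal measure_ball_lt_top.ne,
    ENNReal.div_mul_cancel (Metric.measure_ball_pos _ _ one_pos).ne' measure_ball_lt_top.ne]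

/-- The mass of the kernel outside the ball of volume `a` centred at the origin. -/
noncomputable def tailMass (ν : E d → ℝ≥0∞) (a : ℝ≥0∞) : ℝ≥0∞ :=
  ∫⁻ h in (Metric.ball (0 : E d) (ballRadius d a))ᶜ, ν h

theorem wFun_eq (hd : 1 ≤ d) {a : ℝ≥0∞} (ha : a ≠ ∞) :
    wFun ν p a = (a * tailMass ν a) ^ (1 / p) := by
  rw [wFun, if_neg ha, volume_ball_ballRadius hd ha, tailMass]

theorem HasCriticalYoung.map_top (hd : 1 ≤ d) (hp : 0 < p) (h : HasCriticalYoung ν p) :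
    criticalFun ν p ∞ = ∞ := by
  have : recipW ν p ∞ = ∞ := by
    rw [recipW, ENNReal.inv_top, wFun_eq hd ENNReal.zero_ne_top, zero_mul,
      ENNReal.zero_rpow_of_pos (by positivity), ENNReal.inv_zero]
  conv_lhs => rw [← this]
  exact h.criticalFun_recipW ∞

/-- The working form of the definition of `φ`: it turns statements about `a * tailMass ν a` into
statements about `a`. -/
theorem HasCriticalYoung.powComp_inv (hd : 1 ≤ d) (h : HasCriticalYoung ν p)
    {a : ℝ≥0∞} (ha : a ≠ ∞) : powComp (criticalFun ν p) p (a * tailMass ν a)⁻¹ = a⁻¹ := by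
  rw [powComp, ENNReal.inv_rpow, ← wFun_eq hd ha]
  simpa [recipW] using h.criticalFun_recipW a⁻¹

theorem HasCriticalYoung.monotone (hd : 1 ≤ d) (hp : 0 < p) (h : HasCriticalYoung ν p) :
    Monotone (criticalFun ν p) := h.young.monotone (h.map_top hd hp)

/-- A monotone surjection has no jumps. -/
theorem HasCriticalYoung.continuous (hd : 1 ≤ d) (hp : 0 < p) (h : HasCriticalYoung ν p) :
    Continuous (criticalFun ν p) :=
  (h.monotone hd hp).continuous_of_surjective h.criticalFun_bijective.2

theorem HasCriticalYoung.eq_zero_iff (h : HasCriticalYoung ν p) {x : ℝ≥0∞} :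
    criticalFun ν p x = 0 ↔ x = 0 :=
  ⟨fun hx => h.criticalFun_bijective.1 (hx.trans h.young.map_zero.symm),
    fun hx => hx ▸ h.young.map_zero⟩

theorem HasCriticalYoung.eq_top_iff (hd : 1 ≤ d) (hp : 0 < p) (h : HasCriticalYoung ν p)
    {x : ℝ≥0∞} : criticalFun ν p x = ∞ ↔ x = ∞ :=
  ⟨fun hx => h.criticalFun_bijective.1 (hx.trans (h.map_top hd hp).symm),
    fun hx => hx ▸ h.map_top hd hp⟩

theorem HasCriticalYoung.powComp_eq_top_iff (hd : 1 ≤ d) (hp : 0 < p) (h : HasCriticalYoung ν p)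
    {x : ℝ≥0∞} : powComp (criticalFun ν p) p x = ∞ ↔ x = ∞ := by
  rw [powComp, h.eq_top_iff hd hp, ENNReal.rpow_eq_top_iff_of_pos (by positivity)]

theorem HasCriticalYoung.powComp_eq_zero_iff (hp : 0 < p) (h : HasCriticalYoung ν p)
    {x : ℝ≥0∞} : powComp (criticalFun ν p) p x = 0 ↔ x = 0 := by
  rw [powComp, h.eq_zero_iff, ENNReal.rpow_eq_zero_iff_of_pos (by positivity)]

theorem HasCriticalYoung.powComp_strictMono (hd : 1 ≤ d) (hp : 0 < p) (h : HasCriticalYoung ν p) :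
    StrictMono (powComp (criticalFun ν p) p) :=
  ((h.monotone hd hp).strictMono_of_injective h.criticalFun_bijective.1).comp
    (ENNReal.strictMono_rpow_of_pos (by positivity))

/-- The tail mass decreases in the volume, so this is not automatic: it holds because the strictly
increasing `φ_p` sends the reciprocals of the two sides to `a⁻¹` and `b⁻¹`. -/
theorem HasCriticalYoung.mul_tailMass_mono (hd : 1 ≤ d) (hp : 0 < p) (h : HasCriticalYoung ν p)
    {a b : ℝ≥0∞} (hb : b ≠ ∞) (hab : a ≤ b) : a * tailMass ν a ≤ b * tailMass ν b := by
  have ha : a ≠ ∞ := ne_top_of_le_ne_top hb hab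
  rw [← ENNReal.inv_le_inv, ← (h.powComp_strictMono hd hp).le_iff_le, h.powComp_inv hd ha,
    h.powComp_inv hd hb, ENNReal.inv_le_inv]
  exact hab

theorem HasCriticalYoung.mul_tailMass_ne_top (hd : 1 ≤ d) (hp : 0 < p) (h : HasCriticalYoung ν p)
    {a : ℝ≥0∞} (ha : a ≠ ∞) : a * tailMass ν a ≠ ∞ := by
  intro h0
  have := h.powComp_inv hd ha
  rw [h0, ENNReal.inv_top, (h.powComp_eq_zero_iff hp).2 rfl] at this
  exact ha (ENNReal.inv_eq_zero.1 this.symm)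

theorem HasCriticalYoung.mul_tailMass_ne_zero (hd : 1 ≤ d) (hp : 0 < p) (h : HasCriticalYoung ν p)
    {a : ℝ≥0∞} (ha : a ≠ ∞) (ha0 : a ≠ 0) : a * tailMass ν a ≠ 0 := by
  intro h0
  have := h.powComp_inv hd ha
  rw [h0, ENNReal.inv_zero, (h.powComp_eq_top_iff hd hp).2 rfl] at this
  exact ha0 (ENNReal.inv_eq_top.1 this.symm)

end Critical

/-- Compare `A` with the centred ball `B` of equal volume. The sets `A \ B` and `B \ A` have the
same measure, and the supremum `c` of `κ ν` off `B` bounds `ν` from below on `B` away from the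
origin. Trading one set for the other therefore costs only the factor `κ`. -/
theorem IsAlmostDecreasingLevyKernel.tailMass_le {d : ℕ} (hd : 1 ≤ d) {ν : E d → ℝ≥0∞} {p κ : ℝ}
    (hA : IsAlmostDecreasingLevyKernel ν p κ) {A : Set (E d)} (hAm : MeasurableSet A)
    (hfin : volume A ≠ ∞) :
    ENNReal.ofReal κ * tailMass ν (volume A) ≤ ∫⁻ y in Aᶜ, ν y := by
  have : Nonempty (Fin d) := ⟨⟨0, hd⟩⟩
  set B := Metric.ball (0 : E d) (ballRadius d (volume A)) with hB
  have hBm : MeasurableSet B := measurableSet_ball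
  have hBA : volume B = volume A := volume_ball_ballRadius hd hfin
  set c : ℝ≥0∞ := ⨆ h ∈ Bᶜ, ENNReal.ofReal κ * ν h with hc
  have hle : ∀ y ∈ B, y ≠ 0 → c ≤ ν y := by
    intro y hy hy0
    refine iSup₂_le fun z hz => hA.almost_decreasing z y hy0 ?_
    simp only [hB, mem_compl_iff, Metric.mem_ball, dist_zero_right, not_lt] at hy hz
    linarith
  have hdiff : volume (A \ B) = volume (B \ A) := by
    rw [measure_sdiff_symm hAm.nullMeasurableSet hBm.nullMeasurableSet hBA.symm
      (ne_top_of_le_ne_top hfin (measure_mono inter_subset_left))]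
  have hκ : ENNReal.ofReal κ ≤ 1 := by simpa using hA.kappa_le_one
  rw [tailMass, ← lintegral_const_mul _ hA.measurable, ← lintegral_inter_add_sdiff _ Bᶜ hAm]
  calc (∫⁻ x in Bᶜ ∩ A, ENNReal.ofReal κ * ν x) + ∫⁻ x in Bᶜ \ A, ENNReal.ofReal κ * ν x
      ≤ (∫⁻ x in Bᶜ ∩ A, c) + ∫⁻ x in Bᶜ \ A, ν x := by
        gcongr ?_ + ?_
        · exact setLIntegral_mono measurable_const fun x hx =>
            le_iSup₂ (f := fun h (_ : h ∈ Bᶜ) => ENNReal.ofReal κ * ν h) x hx.1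
        · exact lintegral_mono fun x => mul_le_of_le_one_left (zero_le) hκ
    _ = (∫⁻ x in B \ A, c) + ∫⁻ x in Bᶜ \ A, ν x := by
        rw [setLIntegral_const, setLIntegral_const, inter_comm, ← sdiff_eq, hdiff]
    _ ≤ (∫⁻ x in B \ A, ν x) + ∫⁻ x in Bᶜ \ A, ν x := by
        gcongr ?_ + _
        refine lintegral_mono_ae ?_
        have h0 : ∀ᵐ x ∂(volume.restrict (B \ A)), x ≠ (0 : E d) :=
          ae_restrict_of_ae (by simp [ae_iff])
        filter_upwards [h0, ae_restrict_mem (hBm.diff hAm)] with x hx0 hx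
        exact hle x hx.1 hx0
    _ = ∫⁻ y in Aᶜ, ν y := by
        rw [← lintegral_inter_add_sdiff ν Aᶜ hBm]
        congr 3
        · ext x; simp [and_comm]
        · ext x; simp [and_comm]

/-! ### Jensen's inequality along a sequence of volumes. -/

section Sequence

variable {d : ℕ} {ν : E d → ℝ≥0∞} {p θ : ℝ}

theorem tsum_pow_mul_tailMass_ne_top (hd : 1 ≤ d) (hp : 0 < p) (hB : HasCriticalYoung ν p)
    {a : ℕ → ℝ≥0∞} {A : ℝ≥0∞} (hA : A ≠ ∞) (haA : ∀ k, a k ≤ A) {q : ℝ≥0∞} (hq : q < 1) :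
    ∑' k, q ^ (k + 1) * (a (k + 1) * tailMass ν (a (k + 1))) ≠ ∞ := by
  have hF := hB.mul_tailMass_ne_top hd hp hA
  refine ne_top_of_le_ne_top (b := (1 - q)⁻¹ * (A * tailMass ν A)) ?_ ?_
  · refine ENNReal.mul_ne_top ?_ hF
    exact ENNReal.inv_ne_top.2 (tsub_pos_of_lt hq).ne'
  · rw [← ENNReal.tsum_geometric, ← ENNReal.tsum_mul_right]
    refine ENNReal.tsum_le_tsum fun k => ?_
    gcongr ?_ * ?_
    · exact pow_le_pow_of_le_one (zero_le) hq.le (Nat.le_succ k)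
    · exact hB.mul_tailMass_mono hd hp hA (haA _)

/-- A discrete Jensen inequality for the growth condition. -/
theorem GrowthCondition.powComp_mul_tsum_le (hd : 1 ≤ d) (hp : 0 < p) (hB : HasCriticalYoung ν p)
    (hC : GrowthCondition (criticalFun ν p) p θ)
    {a : ℕ → ℝ≥0∞} (hmono : Monotone a) (h0 : a 0 = 0) {A : ℝ≥0∞} (hA : A ≠ ∞)
    (haA : ∀ k, a k ≤ A) {q : ℝ≥0∞} (hq0 : q ≠ 0) (hq : q < 1) :
    powComp (criticalFun ν p) p (ENNReal.ofReal θ ^ p * q) *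
        ∑' k, q ^ (k + 1) * (a (k + 1) * tailMass ν (a (k + 1))) ≤
      ∑' k, q ^ (k + 1) * (a k * tailMass ν (a (k + 1))) := by
  set ψ := powComp (criticalFun ν p) p with hψ
  set F : ℝ≥0∞ → ℝ≥0∞ := fun b => b * tailMass ν b with hFdef
  set S := ∑' k, q ^ (k + 1) * F (a (k + 1)) with hS
  have hSfin : S ≠ ∞ := tsum_pow_mul_tailMass_ne_top hd hp hB hA haA hq
  have hθ : ENNReal.ofReal θ ^ p ≠ 0 := by
    have := hC.theta_pos
    simp [ENNReal.rpow_eq_zero_iff, this, hp]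
  have hθ' : ENNReal.ofReal θ ^ p ≠ ∞ := ENNReal.rpow_ne_top_of_nonneg hp.le ENNReal.ofReal_ne_top
  set x₀ := ENNReal.ofReal θ ^ p * q with hx₀
  have hx₀fin : x₀ ≠ ∞ := ENNReal.mul_ne_top hθ' (ne_top_of_lt hq)
  -- Jensen is carried out through the supporting line of `φ_p` at the expected mean `x₀ = θ^p q`.
  obtain ⟨m, hm, hsub⟩ := hC.young.exists_subgradient
    ((hB.powComp_eq_top_iff hd hp).2 rfl) (fun x hx => mt (hB.powComp_eq_top_iff hd hp).1 hx)
    (mul_ne_zero hθ hq0) hx₀fin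
  have hterm : ∀ k, ψ x₀ * (q ^ (k + 1) * F (a (k + 1))) +
      m * (ENNReal.ofReal θ ^ p * (q ^ (k + 1) * F (a k))) ≤
      q ^ (k + 1) * (a k * tailMass ν (a (k + 1))) + m * x₀ * (q ^ (k + 1) * F (a (k + 1))) := by
    intro k
    have hak := hmono (Nat.le_succ k)
    have hfin : ∀ j, a j ≠ ∞ := fun j => ne_top_of_le_ne_top hA (haA j)
    have hFk : F (a k) ≠ ∞ := hB.mul_tailMass_ne_top hd hp (hfin k)
    rcases eq_or_ne (a (k + 1)) 0 with hz | hz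
    · have : a k = 0 := by simpa [hz] using hak
      simp [hFdef, hz, this]
    have hF1 : F (a (k + 1)) ≠ ∞ := hB.mul_tailMass_ne_top hd hp (hfin _)
    have hF0 : F (a (k + 1)) ≠ 0 := hB.mul_tailMass_ne_zero hd hp (hfin _) hz
    set x := ENNReal.ofReal θ ^ p * (F (a k) / F (a (k + 1))) with hx
    have hxfin : x ≠ ∞ := ENNReal.mul_ne_top hθ' (ENNReal.div_ne_top hFk hF0)
    have hψx : ψ x ≤ a k / a (k + 1) := by
      rcases eq_or_ne (a k) 0 with hz' | hz'
      · have : x = 0 := by simp [hx, hFdef, hz']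
        rw [this, hψ, hC.young.map_zero]
        exact zero_le
      have hFk0 : F (a k) ≠ 0 := hB.mul_tailMass_ne_zero hd hp (hfin _) hz'
      -- Reciprocals reverse the order, so the growth condition applies with `s = 1 / F (a (k+1))`
      -- and `t = 1 / F (a k)`, where `φ_p` equals `1 / a (k+1)` and `1 / a k`.
      have := hC.growth (F (a (k + 1)))⁻¹ (F (a k))⁻¹ (ENNReal.inv_ne_zero.2 hFk)
        (ENNReal.inv_ne_top.2 hFk0)
        (ENNReal.inv_le_inv.2 (hB.mul_tailMass_mono hd hp (hfin _) hak))
      rw [hB.powComp_inv hd (hfin _), hB.powComp_inv hd (hfin _)] at this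
      simpa [hx, div_eq_mul_inv, mul_comm] using this
    have e1 : F (a (k + 1)) * x = ENNReal.ofReal θ ^ p * F (a k) := by
      rw [hx, mul_left_comm, ENNReal.mul_div_cancel hF0 hF1]
    have e2 : F (a (k + 1)) * (a k / a (k + 1)) = a k * tailMass ν (a (k + 1)) := by
      simp only [hFdef]
      rw [mul_right_comm, ENNReal.mul_div_cancel hz (hfin _)]
    calc ψ x₀ * (q ^ (k + 1) * F (a (k + 1))) +
        m * (ENNReal.ofReal θ ^ p * (q ^ (k + 1) * F (a k)))
        = q ^ (k + 1) * F (a (k + 1)) * (ψ x₀ + m * x) := by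
          rw [mul_left_comm (ENNReal.ofReal θ ^ p) (q ^ (k + 1)), ← e1]; ring
      _ ≤ q ^ (k + 1) * F (a (k + 1)) * (ψ x + m * x₀) := by
          gcongr _ * ?_
          exact hsub x hxfin
      _ ≤ q ^ (k + 1) * F (a (k + 1)) * (a k / a (k + 1) + m * x₀) := by gcongr
      _ = q ^ (k + 1) * (a k * tailMass ν (a (k + 1))) +
          m * x₀ * (q ^ (k + 1) * F (a (k + 1))) := by rw [← e2]; ring
  -- Since `F (a 0) = 0`, shifting the index costs exactly one factor `q`: the weighted mean of the
  -- ratios is `q`.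
  have hshift : ∑' k, q ^ (k + 1) * F (a k) = q * S := by
    have h1 : ∑' k, q ^ k * F (a k) = S := by
      rw [tsum_eq_zero_add' ENNReal.summable]
      simp [hFdef, h0, hS]
    rw [← h1, ← ENNReal.tsum_mul_left]
    exact tsum_congr fun k => by ring
  have hsum := ENNReal.tsum_le_tsum hterm
  rw [ENNReal.tsum_add, ENNReal.tsum_add, ENNReal.tsum_mul_left, ENNReal.tsum_mul_left,
    ENNReal.tsum_mul_left, ENNReal.tsum_mul_left, hshift, ← mul_assoc (ENNReal.ofReal θ ^ p),
    ← hx₀, ← mul_assoc m] at hsum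
  -- The linear terms on both sides equal `m * x₀ * S`; cancelling them requires `S` to be finite.
  exact ENNReal.le_of_add_le_add_right (by finiteness) hsum

end Sequence

/-! ### Geometric levels and pointwise differences. -/

section Levels

/-- Superlevel set at the geometric height `M r ^ k`. -/
def superlevel {α : Type*} (v : α → ℝ) (M r : ℝ) (k : ℕ) : Set α := {x | M * r ^ k < v x}

variable {α : Type*} {v : α → ℝ} {M r p : ℝ}

theorem superlevel_mono (hM : 0 ≤ M) (hr : 0 ≤ r) (hr1 : r ≤ 1) : Monotone (superlevel v M r) := by
  intro j k hjk x hx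
  refine lt_of_le_of_lt ?_ (show M * r ^ j < v x from hx)
  gcongr ?_ * ?_
  exact pow_le_pow_of_le_one hr hr1 hjk

/-- Let `K` be the first index with `f K ≠ 0`. Then `X - Y ≥ M r^K (1 - r) ≥ M r^(K+1)`, the last
step using `r ≤ 1/2`, while the geometric tail from `K` on sums to at most `(M r^(K+1))^p`. -/
theorem tsum_geometric_gaps_le (hM : 0 ≤ M) (hr : 0 < r) (hr2 : r ≤ 1 / 2) (hp : 0 < p)
    {X Y : ℝ} {f : ℕ → ℝ≥0∞} (hf1 : ∀ k, f k ≤ 1)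
    (hf0 : ∀ k, f k ≠ 0 → M * r ^ k < X ∧ Y ≤ M * r ^ (k + 1)) :
    ∑' k, ((1 - ENNReal.ofReal r ^ p) * ENNReal.ofReal M ^ p) * (ENNReal.ofReal r ^ p) ^ (k + 1) *
      f k ≤ ENNReal.ofReal (X - Y) ^ p := by
  classical
  have hpow : ∀ n : ℕ, ENNReal.ofReal M ^ p * (ENNReal.ofReal r ^ p) ^ n =
      ENNReal.ofReal (M * r ^ n) ^ p := fun n => by
    rw [ENNReal.ofReal_mul hM, ENNReal.mul_rpow_of_nonneg _ _ hp.le,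
      ENNReal.ofReal_pow hr.le, ← ENNReal.rpow_natCast, ← ENNReal.rpow_mul,
      ← ENNReal.rpow_natCast, ← ENNReal.rpow_mul, mul_comm p]
  generalize ENNReal.ofReal r ^ p = q at *
  by_cases hex : ∃ k, f k ≠ 0
  · obtain ⟨h1, h2⟩ := hf0 _ (Nat.find_spec hex)
    have hmin : ∀ k < Nat.find hex, f k = 0 := fun k hk => not_not.1 (Nat.find_min hex hk)
    generalize Nat.find hex = K at *
    have hlow : ∀ k ∈ Finset.range K, (1 - q) * ENNReal.ofReal M ^ p * q ^ (k + 1) * f k = 0 := by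
      intro k hk
      rw [hmin k (Finset.mem_range.1 hk), mul_zero]
    rw [← Summable.sum_add_tsum_nat_add' (k := K) ENNReal.summable, Finset.sum_eq_zero hlow, zero_add]
    have hgap : M * r ^ (K + 1) ≤ X - Y := by
      have : M * r ^ (K + 1) = r * (M * r ^ K) := by ring
      have h3 : 0 ≤ M * r ^ K := by positivity
      nlinarith
    calc ∑' k, (1 - q) * ENNReal.ofReal M ^ p * q ^ (k + K + 1) * f (k + K)
        ≤ ∑' k, (1 - q) * ENNReal.ofReal M ^ p * q ^ (K + 1) * q ^ k := by
          refine ENNReal.tsum_le_tsum fun k => ?_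
          calc _ ≤ (1 - q) * ENNReal.ofReal M ^ p * q ^ (k + K + 1) * 1 := by
                gcongr; exact hf1 _
            _ = _ := by ring
      _ = ((1 - q) * (1 - q)⁻¹) * (ENNReal.ofReal M ^ p * q ^ (K + 1)) := by
          rw [ENNReal.tsum_mul_left, ENNReal.tsum_geometric]; ring
      _ ≤ 1 * (ENNReal.ofReal M ^ p * q ^ (K + 1)) := by gcongr; exact ENNReal.mul_inv_le_one _
      _ = ENNReal.ofReal (M * r ^ (K + 1)) ^ p := by rw [one_mul, hpow]
      _ ≤ ENNReal.ofReal (X - Y) ^ p := by gcongr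
  · push Not at hex
    simp [hex]

theorem tsum_level_gaps_le_enorm (hM : 0 ≤ M) (hr : 0 < r) (hr2 : r ≤ 1 / 2) (hp : 0 < p)
    (x y : α) :
    ∑' k, ((1 - ENNReal.ofReal r ^ p) * ENNReal.ofReal M ^ p) * (ENNReal.ofReal r ^ p) ^ (k + 1) *
      ((superlevel v M r k).indicator 1 x * (superlevel v M r (k + 1))ᶜ.indicator 1 y +
        (superlevel v M r k).indicator 1 y * (superlevel v M r (k + 1))ᶜ.indicator 1 x) ≤
      ‖v x - v y‖ₑ ^ p := by
  wlog h : v y ≤ v x generalizing x y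
  · have := this y x (le_of_not_ge h)
    rw [← neg_sub, enorm_neg]
    simpa only [add_comm] using this
  -- If `v y ≤ v x`, then `y` cannot lie in a superlevel set while `x` misses the next, larger one,
  -- so only one of the two orderings contributes.
  have hz : ∀ k, ((superlevel v M r k).indicator 1 y *
      (superlevel v M r (k + 1))ᶜ.indicator 1 x : ℝ≥0∞) = 0 := by
    intro k
    rw [mul_eq_zero, indicator_apply_eq_zero, indicator_apply_eq_zero]
    by_contra! hcon
    obtain ⟨⟨h1, -⟩, ⟨h2, -⟩⟩ := hcon
    refine h2 (superlevel_mono hM hr.le (by linarith) (Nat.le_succ k) ?_)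
    exact lt_of_lt_of_le h1 h
  simp only [hz, add_zero]
  rw [Real.enorm_eq_ofReal (sub_nonneg.2 h)]
  refine tsum_geometric_gaps_le (f := fun k => (superlevel v M r k).indicator 1 x *
    (superlevel v M r (k + 1))ᶜ.indicator 1 y) hM hr hr2 hp (fun k => ?_) fun k hk => ?_
  · classical
    simp only [indicator_apply]
    split_ifs <;> simp
  · simp only [ne_eq, mul_eq_zero, not_or, indicator_apply_eq_zero, not_forall] at hk
    obtain ⟨⟨h1, -⟩, ⟨h2, -⟩⟩ := hk
    exact ⟨h1, not_lt.1 h2⟩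

end Levels

/-! ### Seminorm and modular in terms of level volumes. -/

section Core

variable {d : ℕ} {ν : E d → ℝ≥0∞} {p θ κ : ℝ}

theorem IsAlmostDecreasingLevyKernel.apply_sub_comm (hA : IsAlmostDecreasingLevyKernel ν p κ)
    (x y : E d) : ν (x - y) = ν (y - x) := hA.radial _ _ (norm_sub_rev x y)

/-- The reflected translate `x - A` has the volume of `A`. -/
theorem IsAlmostDecreasingLevyKernel.tailMass_le_sub (hd : 1 ≤ d)
    (hA : IsAlmostDecreasingLevyKernel ν p κ) {A : Set (E d)} (hAm : MeasurableSet A)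
    (hfin : volume A ≠ ∞) (x : E d) :
    ENNReal.ofReal κ * tailMass ν (volume A) ≤ ∫⁻ y, Aᶜ.indicator 1 y * ν (x - y) := by
  set A' : Set (E d) := (fun y => x - y) ⁻¹' A with hA'
  have hmp : MeasurePreserving (fun y : E d => x - y) volume volume :=
    Measure.measurePreserving_sub_left volume x
  have hvol : volume A' = volume A := hmp.measure_preimage hAm.nullMeasurableSet
  have hA'm : MeasurableSet A' := hmp.measurable hAm
  rw [← hvol]
  refine (hA.tailMass_le hd hA'm (hvol ▸ hfin)).trans_eq ?_
  rw [← lintegral_indicator hA'm.compl,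
    ← lintegral_sub_left_eq_self (fun y => Aᶜ.indicator 1 y * ν (x - y)) x]
  refine lintegral_congr fun y => ?_
  by_cases hy : x - y ∈ A
  · rw [indicator_of_notMem (by simpa [hA'] using hy), indicator_of_notMem (by simpa using hy),
      zero_mul]
  · rw [indicator_of_mem (by simpa [hA'] using hy), indicator_of_mem (by simpa using hy)]
    simp

theorem measurableSet_superlevel {v : E d → ℝ} (hv : Measurable v) (M r : ℝ) (k : ℕ) :
    MeasurableSet (superlevel v M r k) := measurableSet_lt measurable_const hv

/-- The pointwise level bound is integrated against `ν (x - y)`. The factor `2` counts the two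
orderings of a pair, which contribute equally because `ν` is even. -/
theorem IsAlmostDecreasingLevyKernel.level_sum_le (hd : 1 ≤ d) (hp : 0 < p)
    (hA : IsAlmostDecreasingLevyKernel ν p κ) {v : E d → ℝ} (hv : Measurable v)
    {M r : ℝ} (hM : 0 ≤ M) (hr : 0 < r) (hr2 : r ≤ 1 / 2)
    (hfin : ∀ k, volume (superlevel v M r k) ≠ ∞) :
    2 * ENNReal.ofReal κ * (1 - ENNReal.ofReal r ^ p) * ENNReal.ofReal M ^ p *
      ∑' k, (ENNReal.ofReal r ^ p) ^ (k + 1) *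
        (volume (superlevel v M r k) * tailMass ν (volume (superlevel v M r (k + 1)))) ≤
      ∫⁻ x, ∫⁻ y, ‖v x - v y‖ₑ ^ p * ν (x - y) := by
  have hνm := hA.measurable
  set q := ENNReal.ofReal r ^ p with hq
  set I : ℕ → E d → ℝ≥0∞ := fun k => (superlevel v M r k).indicator 1 with hI
  set J : ℕ → E d → ℝ≥0∞ := fun k => (superlevel v M r (k + 1))ᶜ.indicator 1 with hJ
  have hIm : ∀ k, Measurable (I k) := fun k =>
    measurable_one.indicator (measurableSet_superlevel hv M r k)
  have hJm : ∀ k, Measurable (J k) := fun k =>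
    measurable_one.indicator (measurableSet_superlevel hv M r (k + 1)).compl
  set C := (1 - q) * ENNReal.ofReal M ^ p with hC
  have hswap : ∀ k, ∫⁻ x, ∫⁻ y, I k y * J k x * ν (x - y) =
      ∫⁻ x, ∫⁻ y, I k x * J k y * ν (x - y) := by
    intro k
    rw [lintegral_lintegral_swap (by fun_prop)]
    simp_rw [fun x y => hA.apply_sub_comm x y]
  have hone : ∀ k, volume (superlevel v M r k) *
      (ENNReal.ofReal κ * tailMass ν (volume (superlevel v M r (k + 1)))) ≤
      ∫⁻ x, ∫⁻ y, I k x * J k y * ν (x - y) := by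
    intro k
    calc volume (superlevel v M r k) *
        (ENNReal.ofReal κ * tailMass ν (volume (superlevel v M r (k + 1))))
        = ∫⁻ x, I k x * (ENNReal.ofReal κ * tailMass ν (volume (superlevel v M r (k + 1)))) := by
          rw [lintegral_mul_const _ (hIm k),
            lintegral_indicator_one (measurableSet_superlevel hv M r k)]
      _ ≤ ∫⁻ x, I k x * ∫⁻ y, J k y * ν (x - y) := by
          gcongr with x
          exact hA.tailMass_le_sub hd (measurableSet_superlevel hv M r (k + 1)) (hfin _) x
      _ = ∫⁻ x, ∫⁻ y, I k x * J k y * ν (x - y) := by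
          refine lintegral_congr fun x => ?_
          rw [← lintegral_const_mul _ (by fun_prop)]
          simp_rw [mul_assoc]
  calc 2 * ENNReal.ofReal κ * (1 - q) * ENNReal.ofReal M ^ p *
      ∑' k, q ^ (k + 1) *
        (volume (superlevel v M r k) * tailMass ν (volume (superlevel v M r (k + 1))))
      = ∑' k, C * q ^ (k + 1) * (2 * (volume (superlevel v M r k) *
          (ENNReal.ofReal κ * tailMass ν (volume (superlevel v M r (k + 1)))))) := by
        rw [← ENNReal.tsum_mul_left]
        refine tsum_congr fun k => ?_
        rw [hC]; ring
    _ ≤ ∑' k, C * q ^ (k + 1) * (∫⁻ x, ∫⁻ y, I k x * J k y * ν (x - y) +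
          I k y * J k x * ν (x - y)) := by
        refine ENNReal.tsum_le_tsum fun k => ?_
        gcongr _ * ?_
        have : ∫⁻ x, ∫⁻ y, I k x * J k y * ν (x - y) + I k y * J k x * ν (x - y) =
            2 * ∫⁻ x, ∫⁻ y, I k x * J k y * ν (x - y) := by
          rw [two_mul]
          trans (∫⁻ x, ∫⁻ y, I k x * J k y * ν (x - y)) + ∫⁻ x, ∫⁻ y, I k y * J k x * ν (x - y)
          swap
          · rw [hswap k]
          rw [← lintegral_add_left (by fun_prop)]
          refine lintegral_congr fun x => ?_
          rw [← lintegral_add_left (by fun_prop)]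
        rw [this]
        gcongr
        exact hone k
    _ = ∫⁻ x, ∫⁻ y, (∑' k, C * q ^ (k + 1) * (I k x * J k y + I k y * J k x)) * ν (x - y) := by
        rw [tsum_congr fun k => (lintegral_const_mul _ (by fun_prop)).symm,
          ← lintegral_tsum (by fun_prop)]
        refine lintegral_congr fun x => ?_
        rw [tsum_congr fun k => (lintegral_const_mul _ (by fun_prop)).symm,
          ← lintegral_tsum (by fun_prop)]
        refine lintegral_congr fun y => ?_
        rw [← ENNReal.tsum_mul_right]
        exact tsum_congr fun k => by ring
    _ ≤ ∫⁻ x, ∫⁻ y, ‖v x - v y‖ₑ ^ p * ν (x - y) := by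
        gcongr with x y
        exact tsum_level_gaps_le_enorm hM hr hr2 hp x y

/-- On the layer `M r^(k+1) < v ≤ M r^k`, `hS` gives `(v / l)^p ≤ q^(k+1) / S`. This is `1 / F (a
(k+1))` times the weight `q^(k+1) F (a (k+1)) / S ≤ 1`, so by convexity the layer contributes at
most its weight; the weights sum to at most `1`. -/
theorem HasCriticalYoung.modular_le_one (hd : 1 ≤ d) (hp : 0 < p) (hB : HasCriticalYoung ν p)
    (hC : GrowthCondition (criticalFun ν p) p θ) {v : E d → ℝ} (hv : Measurable v)
    (hv0 : ∀ x, 0 ≤ v x) {M r : ℝ} (hM : 0 < M) (hvM : ∀ x, v x ≤ M) (hr : 0 < r) (hr1 : r < 1)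
    (hfin : volume {x | 0 < v x} ≠ ∞) {l : ℝ≥0} (hl : 0 < l)
    (hS : ENNReal.ofReal M ^ p * ∑' k, (ENNReal.ofReal r ^ p) ^ (k + 1) *
      (volume (superlevel v M r (k + 1)) * tailMass ν (volume (superlevel v M r (k + 1)))) ≤
      ENNReal.ofReal r ^ p * (l : ℝ≥0∞) ^ p) :
    modular (criticalFun ν p) v l ≤ 1 := by
  set q := ENNReal.ofReal r ^ p with hq
  set a : ℕ → ℝ≥0∞ := fun k => volume (superlevel v M r k) with ha
  set F : ℝ≥0∞ → ℝ≥0∞ := fun b => b * tailMass ν b with hF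
  set ψ := powComp (criticalFun ν p) p with hψ
  set S := ∑' k, q ^ (k + 1) * F (a (k + 1)) with hSdef
  have hq0 : q ≠ 0 := by simp [hq, ENNReal.rpow_eq_zero_iff, hr, hp]
  have hq1 : q < 1 := ENNReal.rpow_lt_one (by simpa using hr1) hp
  have haA : ∀ k, a k ≤ volume {x | 0 < v x} := fun k => measure_mono fun x hx =>
    lt_trans (by positivity) (show M * r ^ k < v x from hx)
  have hafin : ∀ k, a k ≠ ∞ := fun k => ne_top_of_le_ne_top hfin (haA k)
  have hSfin : S ≠ ∞ := tsum_pow_mul_tailMass_ne_top hd hp hB hfin haA hq1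
  have hβ : ∀ k, q ^ (k + 1) * F (a (k + 1)) ≤ S := fun k => ENNReal.le_tsum (f := fun k =>
    q ^ (k + 1) * F (a (k + 1))) k
  have hlevel : ∀ k, a (k + 1) * ψ (q ^ (k + 1) / S) ≤ q ^ (k + 1) * F (a (k + 1)) / S := by
    intro k
    rcases eq_or_ne (a (k + 1)) 0 with hz | hz
    · simp [hz]
    have hF0 : F (a (k + 1)) ≠ 0 := hB.mul_tailMass_ne_zero hd hp (hafin _) hz
    have hF1 : F (a (k + 1)) ≠ ∞ := hB.mul_tailMass_ne_top hd hp (hafin _)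
    set c := q ^ (k + 1) * F (a (k + 1)) / S with hc
    have hc1 : c ≤ 1 := ENNReal.div_le_of_le_mul (by simpa using hβ k)
    have e : q ^ (k + 1) / S = c * (F (a (k + 1)))⁻¹ := by
      rw [hc, div_eq_mul_inv, div_eq_mul_inv, mul_right_comm _ _ (S⁻¹), mul_assoc (_ * S⁻¹),
        ENNReal.mul_inv_cancel hF0 hF1, mul_one]
    calc a (k + 1) * ψ (q ^ (k + 1) / S) ≤ a (k + 1) * (c * ψ (F (a (k + 1)))⁻¹) := by
          rw [e]; gcongr; exact hC.young.map_mul_le hc1 _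
      _ = a (k + 1) * (a (k + 1))⁻¹ * c := by rw [hψ, hB.powComp_inv hd (hafin _)]; ring
      _ ≤ 1 * c := by gcongr; exact ENNReal.mul_inv_le_one _
      _ = c := one_mul c
  have hpt : ∀ x, criticalFun ν p (‖v x‖ₑ / l) ≤
      ∑' k, (superlevel v M r (k + 1)).indicator 1 x * ψ (q ^ (k + 1) / S) := by
    intro x
    rcases (hv0 x).eq_or_lt with h0 | h0
    · rw [← h0]; simp [hB.young.map_zero]
    obtain ⟨k, hk1, hk2⟩ := exists_nat_pow_near_of_lt_one (div_pos h0 hM)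
      ((div_le_one hM).2 (hvM x)) hr hr1
    rw [lt_div_iff₀ hM, mul_comm] at hk1
    rw [div_le_iff₀ hM, mul_comm] at hk2
    refine le_trans ?_ (ENNReal.le_tsum k)
    rw [indicator_of_mem (show x ∈ superlevel v M r (k + 1) from hk1), Pi.one_apply, one_mul,
      hψ, powComp]
    refine hB.monotone hd hp ?_
    rw [one_div, ENNReal.le_rpow_inv_iff hp, ENNReal.div_rpow_of_nonneg _ _ hp.le,
      Real.enorm_eq_ofReal h0.le]
    have hl0 : (l : ℝ≥0∞) ^ p ≠ 0 := by simp [ENNReal.rpow_eq_zero_iff, hl.ne']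
    have hl1 : (l : ℝ≥0∞) ^ p ≠ ∞ := ENNReal.rpow_ne_top_of_nonneg hp.le ENNReal.coe_ne_top
    rw [ENNReal.le_div_iff_mul_le (.inr (pow_ne_zero _ hq0)) (.inl hSfin), mul_comm,
      ← mul_div_assoc]
    refine ENNReal.div_le_of_le_mul ?_
    calc S * ENNReal.ofReal (v x) ^ p ≤ S * ENNReal.ofReal (M * r ^ k) ^ p := by gcongr
      _ = q ^ k * (ENNReal.ofReal M ^ p * S) := by
          rw [ENNReal.ofReal_mul hM.le, ENNReal.mul_rpow_of_nonneg _ _ hp.le,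
            ENNReal.ofReal_pow hr.le, hq, ← ENNReal.rpow_natCast, ← ENNReal.rpow_mul,
            ← ENNReal.rpow_natCast, ← ENNReal.rpow_mul, mul_comm p]
          ring
      _ ≤ q ^ k * (q * (l : ℝ≥0∞) ^ p) := by gcongr
      _ = q ^ (k + 1) * (l : ℝ≥0∞) ^ p := by ring
  calc modular (criticalFun ν p) v l
      ≤ ∫⁻ x, ∑' k, (superlevel v M r (k + 1)).indicator 1 x * ψ (q ^ (k + 1) / S) :=
        lintegral_mono hpt
    _ = ∑' k, a (k + 1) * ψ (q ^ (k + 1) / S) := by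
        have hm := fun k => (measurable_one (α := ℝ≥0∞)).indicator
          (measurableSet_superlevel hv M r (k + 1))
        rw [lintegral_tsum fun k => ((hm k).mul_const _).aemeasurable]
        refine tsum_congr fun k => ?_
        rw [lintegral_mul_const _ (hm k),
          lintegral_indicator_one (measurableSet_superlevel hv M r (k + 1))]
    _ ≤ ∑' k, q ^ (k + 1) * F (a (k + 1)) / S := ENNReal.tsum_le_tsum hlevel
    _ = S * S⁻¹ := by simp_rw [div_eq_mul_inv]; rw [ENNReal.tsum_mul_right]
    _ ≤ 1 := ENNReal.mul_inv_le_one _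

end Core

/-! ### The Orlicz inequality and the embedding of `W^p_ν`. -/

section Inequality

variable {d : ℕ} {ν : E d → ℝ≥0∞} {p θ κ : ℝ}

/-- The modular estimate for a bounded nonnegative function supported on a set of finite measure. -/
theorem modular_le_one_of_bounded (hd : 1 ≤ d) (hp : 0 < p)
    (hA : IsAlmostDecreasingLevyKernel ν p κ) (hB : HasCriticalYoung ν p)
    (hC : GrowthCondition (criticalFun ν p) p θ) {v : E d → ℝ} (hv : Measurable v)
    (hv0 : ∀ x, 0 ≤ v x) {M r : ℝ} (hM : 0 < M) (hvM : ∀ x, v x ≤ M) (hr : 0 < r)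
    (hr2 : r ≤ 1 / 2) (hfin : volume {x | 0 < v x} ≠ ∞) {l : ℝ≥0} (hl : 0 < l)
    (hl' : ∫⁻ x, ∫⁻ y, ‖v x - v y‖ₑ ^ p * ν (x - y) ≤
      2 * ENNReal.ofReal κ * (1 - ENNReal.ofReal r ^ p) *
        criticalFun ν p (ENNReal.ofReal (θ * r)) * (ENNReal.ofReal r ^ p * (l : ℝ≥0∞) ^ p)) :
    modular (criticalFun ν p) v l ≤ 1 := by
  have hθ := hC.theta_pos
  have hκ := hA.kappa_pos
  refine hB.modular_le_one hd hp hC hv hv0 hM hvM hr (by linarith) hfin hl ?_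
  have hafin : ∀ k, volume (superlevel v M r k) ≠ ∞ := fun k =>
    ne_top_of_le_ne_top hfin (measure_mono fun x hx =>
      lt_trans (by positivity) (show M * r ^ k < v x from hx))
  have hmono : Monotone fun k => volume (superlevel v M r k) := fun j k hjk =>
    measure_mono (superlevel_mono hM.le hr.le (by linarith) hjk)
  have hq1 : ENNReal.ofReal r ^ p < 1 :=
    ENNReal.rpow_lt_one (by rw [ENNReal.ofReal_lt_one]; linarith) hp
  have hq0 : ENNReal.ofReal r ^ p ≠ 0 := by simp [ENNReal.rpow_eq_zero_iff, hr, hp]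
  -- The levels start at the upper bound `M`, which makes the initial volume vanish as the index
  -- shift in Jensen's inequality requires.
  have h0 : volume (superlevel v M r 0) = 0 := by
    have : superlevel v M r 0 = ∅ := by
      ext x; simpa [superlevel] using hvM x
    rw [this, measure_empty]
  have h1 := hC.powComp_mul_tsum_le hd hp hB hmono h0 hfin (fun k => measure_mono fun x hx =>
      lt_trans (by positivity) (show M * r ^ k < v x from hx)) hq0 hq1
  have h2 := hA.level_sum_le hd hp hv hM.le hr hr2 hafin
  have hψ : powComp (criticalFun ν p) p (ENNReal.ofReal θ ^ p * ENNReal.ofReal r ^ p) =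
      criticalFun ν p (ENNReal.ofReal (θ * r)) := by
    rw [powComp, ← ENNReal.mul_rpow_of_nonneg _ _ hp.le, ← ENNReal.rpow_mul,
      mul_one_div_cancel hp.ne', ENNReal.rpow_one, ENNReal.ofReal_mul hθ.le]
  rw [hψ] at h1
  generalize ENNReal.ofReal r ^ p = q at *
  set c := 2 * ENNReal.ofReal κ * (1 - q) * criticalFun ν p (ENNReal.ofReal (θ * r)) with hc
  have hφ0 : criticalFun ν p (ENNReal.ofReal (θ * r)) ≠ 0 := by
    rw [ne_eq, hB.eq_zero_iff]
    simpa using mul_pos hθ hr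
  have hφ1 : criticalFun ν p (ENNReal.ofReal (θ * r)) ≠ ∞ := by
    rw [ne_eq, hB.eq_top_iff hd hp]
    exact ENNReal.ofReal_ne_top
  have hc0 : c ≠ 0 := by
    have : (1 - q) ≠ 0 := (tsub_pos_of_lt hq1).ne'
    simp [hc, hκ, this, hφ0]
  have hc1 : c ≠ ∞ := by
    have : (1 - q) ≠ ∞ := ne_top_of_le_ne_top ENNReal.one_ne_top tsub_le_self
    finiteness
  -- Multiplying by the positive finite constant `c` reduces the claim to the chain Jensen, level
  -- sum, hypothesis on the seminorm.
  refine (ENNReal.mul_le_mul_iff_right hc0 hc1).1 ?_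
  refine le_trans ?_ hl'
  refine le_trans ?_ h2
  calc _ = 2 * ENNReal.ofReal κ * (1 - q) * ENNReal.ofReal M ^ p *
        (criticalFun ν p (ENNReal.ofReal (θ * r)) * ∑' k, q ^ (k + 1) *
        (volume (superlevel v M r (k + 1)) * tailMass ν (volume (superlevel v M r (k + 1))))) := by
        rw [hc]; ring
    _ ≤ _ := by gcongr

/-- Truncation of `|u|` at the heights `1 / (n + 1)` and `n + 1`. -/
noncomputable def truncate {α : Type*} (u : α → ℝ) (n : ℕ) (x : α) : ℝ :=
  min (max (|u x| - 1 / (n + 1)) 0) (n + 1)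

theorem enorm_truncate_sub_le {α : Type*} (u : α → ℝ) (n : ℕ) (x y : α) :
    ‖truncate u n x - truncate u n y‖ₑ ≤ ‖u x - u y‖ₑ := by
  rw [enorm_le_iff_norm_le, Real.norm_eq_abs, Real.norm_eq_abs]
  refine (abs_inf_sub_inf_le_abs _ _ _).trans ((abs_sup_sub_sup_le_abs _ _ _).trans ?_)
  rw [sub_sub_sub_cancel_right]
  exact abs_abs_sub_abs_le _ _

theorem tendsto_truncate {α : Type*} (u : α → ℝ) (x : α) :
    Tendsto (fun n => truncate u n x) atTop (𝓝 |u x|) := by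
  have h1 : Tendsto (fun n : ℕ => max (|u x| - 1 / ((n : ℝ) + 1)) 0) atTop (𝓝 |u x|) := by
    have := (tendsto_const_nhds (x := |u x|)).sub (tendsto_one_div_add_atTop_nhds_zero_nat (𝕜 := ℝ))
    have := this.max (tendsto_const_nhds (x := (0 : ℝ)))
    simpa using this
  refine h1.congr' ?_
  obtain ⟨N, hN⟩ := exists_nat_gt |u x|
  filter_upwards [eventually_ge_atTop N] with n hn
  have hn' : (N : ℝ) ≤ n := by exact_mod_cast hn
  have : (0 : ℝ) < 1 / (n + 1) := by positivity
  have h0 := abs_nonneg (u x)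
  rw [truncate, min_eq_left]
  exact max_le (by linarith) (by linarith)

/-- Truncation does not increase differences, hence not the seminorm; Fatou and continuity of `φ`
carry the modular bound to the limit. -/
theorem modular_le_one (hd : 1 ≤ d) (hp : 0 < p)
    (hA : IsAlmostDecreasingLevyKernel ν p κ) (hB : HasCriticalYoung ν p)
    (hC : GrowthCondition (criticalFun ν p) p θ) {u : E d → ℝ} (hu : Measurable u)
    (hfin : ∀ s : ℝ, 0 < s → volume {x | s < |u x|} ≠ ∞) {r : ℝ} (hr : 0 < r)
    (hr2 : r ≤ 1 / 2) {l : ℝ≥0} (hl : 0 < l)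
    (hl' : ∫⁻ x, ∫⁻ y, ‖u x - u y‖ₑ ^ p * ν (x - y) ≤
      2 * ENNReal.ofReal κ * (1 - ENNReal.ofReal r ^ p) *
        criticalFun ν p (ENNReal.ofReal (θ * r)) * (ENNReal.ofReal r ^ p * (l : ℝ≥0∞) ^ p)) :
    modular (criticalFun ν p) u l ≤ 1 := by
  have hcont := hB.continuous hd hp
  have hmeas : ∀ n, Measurable (truncate u n) := fun n => by
    unfold truncate
    fun_prop
  have hn : ∀ n, modular (criticalFun ν p) (truncate u n) l ≤ 1 := by
    intro n
    refine modular_le_one_of_bounded hd hp hA hB hC (hmeas n) (M := n + 1)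
      (fun x => le_min (le_max_right _ _) (by positivity)) (by positivity)
      (fun x => min_le_right _ _) hr hr2 ?_ hl (le_trans ?_ hl')
    -- Subtracting `1 / (n + 1)` confines the support to a superlevel set of positive height.
    · refine ne_top_of_le_ne_top (hfin (1 / (n + 1)) (by positivity)) (measure_mono fun x hx => ?_)
      have hx : 0 < truncate u n x := hx
      have := (lt_min_iff.1 hx).1
      rcases lt_max_iff.1 this with h | h
      · exact sub_pos.1 h
      · exact absurd h (lt_irrefl _)
    · gcongr
      exact enorm_truncate_sub_le u n _ _
  have hl0 : (l : ℝ≥0∞) ≠ 0 := by exact_mod_cast hl.ne'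
  have hlim : ∀ x, Tendsto (fun n => criticalFun ν p (‖truncate u n x‖ₑ / l)) atTop
      (𝓝 (criticalFun ν p (‖u x‖ₑ / l))) := by
    intro x
    refine (hcont.tendsto _).comp ?_
    refine ENNReal.Tendsto.div_const ?_ (.inr hl0)
    have := (continuous_enorm.tendsto |u x|).comp (tendsto_truncate u x)
    simpa [Function.comp_def] using this
  calc modular (criticalFun ν p) u l
      = ∫⁻ x, liminf (fun n => criticalFun ν p (‖truncate u n x‖ₑ / l)) atTop := by
        refine lintegral_congr fun x => ((hlim x).liminf_eq).symm
    _ ≤ liminf (fun n => modular (criticalFun ν p) (truncate u n) l) atTop := by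
        refine lintegral_liminf_le fun n => hcont.measurable.comp ?_
        have := hmeas n
        fun_prop
    _ ≤ 1 := by
        refine (liminf_le_liminf (Eventually.of_forall hn)).trans ?_
        simp

theorem lintegral_difference_congr {u v : E d → ℝ} (h : u =ᵐ[volume] v) :
    ∫⁻ x, ∫⁻ y, ‖u x - u y‖ₑ ^ p * ν (x - y) = ∫⁻ x, ∫⁻ y, ‖v x - v y‖ₑ ^ p * ν (x - y) := by
  refine lintegral_congr_ae ?_
  filter_upwards [h] with x hx
  refine lintegral_congr_ae ?_
  filter_upwards [h] with y hy
  rw [hx, hy]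

theorem nonlocalSeminorm_congr {u v : E d → ℝ} (h : u =ᵐ[volume] v) :
    nonlocalSeminorm ν p u = nonlocalSeminorm ν p v := by
  rw [nonlocalSeminorm, nonlocalSeminorm, lintegral_difference_congr h]

theorem modular_congr {φ : ℝ≥0∞ → ℝ≥0∞} {u v : E d → ℝ} (h : u =ᵐ[volume] v) (l : ℝ≥0) :
    modular φ u l = modular φ v l := by
  refine lintegral_congr_ae ?_
  filter_upwards [h] with x hx
  rw [hx]

/-- The constant obtained from geometric levels of ratio `1 / t`. -/
noncomputable def levelConst (ν : E d → ℝ≥0∞) (p κ θ t : ℝ) : ℝ≥0∞ :=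
  ENNReal.ofReal t * (2 * ENNReal.ofReal κ * (1 - ENNReal.ofReal t⁻¹ ^ p) *
    criticalFun ν p (ENNReal.ofReal (θ / t))) ^ (-(1 / p))

theorem levelConst_ne_top (hp : 0 < p)
    (hA : IsAlmostDecreasingLevyKernel ν p κ) (hB : HasCriticalYoung ν p)
    (hC : GrowthCondition (criticalFun ν p) p θ) {t : ℝ} (ht : 2 ≤ t) :
    levelConst ν p κ θ t ≠ ∞ := by
  have hθ := hC.theta_pos
  have hκ := hA.kappa_pos
  have hq1 : ENNReal.ofReal t⁻¹ ^ p < 1 :=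
    ENNReal.rpow_lt_one (by rw [ENNReal.ofReal_lt_one]; exact inv_lt_one_of_one_lt₀ (by linarith)) hp
  have hφ0 : criticalFun ν p (ENNReal.ofReal (θ / t)) ≠ 0 := by
    rw [ne_eq, hB.eq_zero_iff]
    simpa using div_pos hθ (by linarith)
  have : (1 - ENNReal.ofReal t⁻¹ ^ p) ≠ 0 := (tsub_pos_of_lt hq1).ne'
  refine ENNReal.mul_ne_top ENNReal.ofReal_ne_top ?_
  rw [ENNReal.rpow_neg, ne_eq, ENNReal.inv_eq_top, ENNReal.rpow_eq_zero_iff_of_pos (by positivity)]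
  simp [hκ, this, hφ0]

theorem modular_le_one_of_levelConst_le (hd : 1 ≤ d) (hp : 0 < p)
    (hA : IsAlmostDecreasingLevyKernel ν p κ) (hB : HasCriticalYoung ν p)
    (hC : GrowthCondition (criticalFun ν p) p θ) {u : E d → ℝ} (hu : AEStronglyMeasurable u volume)
    (hfin : ∀ s : ℝ, 0 < s → volume {x | s < |u x|} ≠ ∞) {t : ℝ} (ht : 2 ≤ t) {l : ℝ≥0}
    (hl : 0 < l) (hl' : levelConst ν p κ θ t * nonlocalSeminorm ν p u ≤ l) :
    modular (criticalFun ν p) u l ≤ 1 := by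
  have ht0 : 0 < t := by linarith
  have hae := hu.ae_eq_mk
  rw [nonlocalSeminorm_congr hae] at hl'
  rw [modular_congr hae]
  refine modular_le_one hd hp hA hB hC hu.stronglyMeasurable_mk.measurable ?_ (inv_pos.2 ht0)
    (by rw [one_div]; exact inv_anti₀ two_pos ht) hl ?_
  · intro s hs
    rw [← measure_congr (s := {x | s < |u x|})]
    · exact hfin s hs
    · filter_upwards [hae] with x hx
      change (s < |u x|) = (s < |hu.mk u x|)
      rw [hx]
  have hθ := hC.theta_pos
  have hκ := hA.kappa_pos
  have hq1 : ENNReal.ofReal t⁻¹ ^ p < 1 :=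
    ENNReal.rpow_lt_one (by rw [ENNReal.ofReal_lt_one]; exact inv_lt_one_of_one_lt₀ (by linarith)) hp
  have hφ0 : criticalFun ν p (ENNReal.ofReal (θ / t)) ≠ 0 := by
    rw [ne_eq, hB.eq_zero_iff]
    simpa using div_pos hθ (by linarith)
  have hφ1 : criticalFun ν p (ENNReal.ofReal (θ / t)) ≠ ∞ := by
    rw [ne_eq, hB.eq_top_iff hd hp]
    exact ENNReal.ofReal_ne_top
  have h1q : (1 - ENNReal.ofReal t⁻¹ ^ p) ≠ 0 := (tsub_pos_of_lt hq1).ne'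
  have h1q' : (1 - ENNReal.ofReal t⁻¹ ^ p) ≠ ∞ :=
    ne_top_of_le_ne_top ENNReal.one_ne_top tsub_le_self
  rw [levelConst, nonlocalSeminorm] at hl'
  rw [← div_eq_mul_inv]
  set c := 2 * ENNReal.ofReal κ * (1 - ENNReal.ofReal t⁻¹ ^ p) *
    criticalFun ν p (ENNReal.ofReal (θ / t)) with hc
  have hc0 : c ≠ 0 := by simp [hc, hκ, h1q, hφ0]
  have hc1 : c ≠ ∞ := by finiteness
  set I := ∫⁻ x, ∫⁻ y, ‖hu.mk u x - hu.mk u y‖ₑ ^ p * ν (x - y)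
  have hT0 : ENNReal.ofReal t ^ p ≠ 0 := by simp [ENNReal.rpow_eq_zero_iff, ht0]
  have hT1 : ENNReal.ofReal t ^ p ≠ ∞ := ENNReal.rpow_ne_top_of_nonneg hp.le ENNReal.ofReal_ne_top
  have key := ENNReal.rpow_le_rpow hl' hp.le
  rw [ENNReal.mul_rpow_of_nonneg _ _ hp.le, ENNReal.mul_rpow_of_nonneg _ _ hp.le,
    ← ENNReal.rpow_mul, ← ENNReal.rpow_mul, neg_mul, one_div_mul_cancel hp.ne', ENNReal.rpow_one,
    ENNReal.rpow_neg_one] at key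
  rw [ENNReal.ofReal_inv_of_pos ht0, ENNReal.inv_rpow]
  calc I = c * ((ENNReal.ofReal t ^ p)⁻¹ * (ENNReal.ofReal t ^ p * c⁻¹ * I)) := by
        rw [← mul_assoc (ENNReal.ofReal t ^ p)⁻¹, ← mul_assoc (ENNReal.ofReal t ^ p)⁻¹,
          ENNReal.inv_mul_cancel hT0 hT1, one_mul, ← mul_assoc, ENNReal.mul_inv_cancel hc0 hc1,
          one_mul]
    _ ≤ c * ((ENNReal.ofReal t ^ p)⁻¹ * (l : ℝ≥0∞) ^ p) := by gcongr

theorem luxemburgNorm_le_levelConst_mul (hd : 1 ≤ d) (hp : 0 < p)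
    (hA : IsAlmostDecreasingLevyKernel ν p κ) (hB : HasCriticalYoung ν p)
    (hC : GrowthCondition (criticalFun ν p) p θ) {u : E d → ℝ} (hu : AEStronglyMeasurable u volume)
    (hfin : ∀ s : ℝ, 0 < s → volume {x | s < |u x|} ≠ ∞) {t : ℝ} (ht : 2 ≤ t) :
    luxemburgNorm (criticalFun ν p) u ≤ levelConst ν p κ θ t * nonlocalSeminorm ν p u := by
  -- The slack `ε` supplies an admissible positive `l` even when the right side is `0`.
  refine ENNReal.le_of_forall_pos_le_add fun ε hε hlt => ?_
  lift levelConst ν p κ θ t * nonlocalSeminorm ν p u to ℝ≥0 using hlt.ne with L hL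
  have hpos : 0 < L + ε := by positivity
  rw [← ENNReal.coe_add]
  refine iInf₂_le_of_le (L + ε) hpos (iInf_le_of_le ?_ le_rfl)
  refine modular_le_one_of_levelConst_le hd hp hA hB hC hu hfin ht hpos ?_
  rw [← hL]
  exact_mod_cast le_self_add

/-- The level argument yields `κ` and `1 - t^(-p)`; these dominate `κ^2` and `(t^p - 2) / (t^p -
1)`, and the power `-1/p` reverses the order. Unlike `Theta`, `levelConst` stays finite at `p = 1`,
`t = 2`. -/
theorem levelConst_le_Theta (hp : 1 ≤ p) (hκ0 : 0 < κ) (hκ1 : κ ≤ 1) {t : ℝ} (ht : 2 ≤ t) :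
    levelConst ν p κ θ t ≤ Theta (criticalFun ν p) p κ θ t := by
  have ht0 : 0 < t := by linarith
  have hp0 : 0 < p := by linarith
  rw [levelConst, Theta, ENNReal.rpow_neg, ENNReal.rpow_neg]
  gcongr
  have htp : 2 ≤ t ^ p := ht.trans (Real.self_le_rpow_of_one_le (by linarith) hp)
  have e : (1 - ENNReal.ofReal t⁻¹ ^ p) = ENNReal.ofReal (1 - (t ^ p)⁻¹) := by
    rw [ENNReal.ofReal_rpow_of_nonneg (by positivity) hp0.le, Real.inv_rpow ht0.le,
      ENNReal.ofReal_sub _ (by positivity), ENNReal.ofReal_one]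
  have e2 : (2 : ℝ≥0∞) = ENNReal.ofReal 2 := by simp
  rw [e, e2, ← ENNReal.ofReal_mul two_pos.le, ← ENNReal.ofReal_mul (by positivity)]
  refine ENNReal.ofReal_le_ofReal ?_
  have h1 : κ ^ 2 ≤ κ := by nlinarith
  have h2 : (t ^ p - 2) / (t ^ p - 1) ≤ 1 - (t ^ p)⁻¹ := by
    rw [div_le_iff₀ (by linarith)]
    have : (1 - (t ^ p)⁻¹) * (t ^ p - 1) = t ^ p - 2 + (t ^ p)⁻¹ := by
      field_simp
      ring
    rw [this]
    have : 0 ≤ (t ^ p)⁻¹ := by positivity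
    linarith
  have h3 : 0 ≤ (t ^ p - 2) / (t ^ p - 1) := div_nonneg (by linarith) (by linarith)
  gcongr

/-- Chebyshev's inequality for `φ(|u| / l)`, since `φ` is positive and finite at positive finite
arguments. -/
theorem volume_superlevel_ne_top_of_mem_orliczSpace (hd : 1 ≤ d) (hp : 0 < p)
    (hB : HasCriticalYoung ν p) {u : E d → ℝ}
    (hu : u ∈ orliczSpace d (criticalFun ν p)) {s : ℝ} (hs : 0 < s) :
    volume {x | s < |u x|} ≠ ∞ := by
  obtain ⟨hum, l, hl, hlfin⟩ := hu
  have hcont := hB.continuous hd hp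
  have hε : criticalFun ν p (ENNReal.ofReal s / l) ≠ 0 := by
    rw [ne_eq, hB.eq_zero_iff]
    simpa [ENNReal.div_eq_zero_iff] using hs
  have hε' : criticalFun ν p (ENNReal.ofReal s / l) ≠ ∞ := by
    rw [ne_eq, hB.eq_top_iff hd hp]
    exact ENNReal.div_ne_top ENNReal.ofReal_ne_top (by exact_mod_cast hl.ne')
  have hm : AEMeasurable (fun x => criticalFun ν p (‖u x‖ₑ / l)) volume := by
    refine hcont.measurable.comp_aemeasurable ?_
    have := hum.aemeasurable
    fun_prop
  refine ne_top_of_le_ne_top (ENNReal.div_ne_top hlfin.ne hε)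
    (le_trans (measure_mono fun x hx => ?_) (meas_ge_le_lintegral_div hm hε hε'))
  have hx : s < |u x| := hx
  refine hB.monotone hd hp ?_
  gcongr
  rw [← ofReal_norm]
  exact ENNReal.ofReal_le_ofReal hx.le

theorem volume_superlevel_ne_top_of_memLp (hp : 0 < p) {u : E d → ℝ}
    (hu : MemLp u (ENNReal.ofReal p) volume) {s : ℝ} (hs : 0 < s) :
    volume {x | s < |u x|} ≠ ∞ := by
  have := hu.meas_ge_lt_top' (by simpa using hp) ENNReal.ofReal_ne_top
    (ε := ENNReal.ofReal s) (by simpa using hs)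
  refine ne_top_of_le_ne_top this.ne (measure_mono fun x hx => ?_)
  have hx : s < |u x| := hx
  change ENNReal.ofReal s ≤ ‖u x‖ₑ
  rw [← ofReal_norm]
  exact ENNReal.ofReal_le_ofReal hx.le

theorem continuouslyEmbeds_nonlocalSpace (hd : 1 ≤ d) (hp : 0 < p)
    (hA : IsAlmostDecreasingLevyKernel ν p κ) (hB : HasCriticalYoung ν p)
    (hC : GrowthCondition (criticalFun ν p) p θ) :
    ContinuouslyEmbeds (nonlocalSpace ν p) (nonlocalNorm ν p)
      (orliczSpace d (criticalFun ν p)) (luxemburgNorm (criticalFun ν p)) := by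
  have hL := levelConst_ne_top hp hA hB hC le_rfl
  refine ⟨fun u hu => ⟨hu.1.1, ?_⟩, (levelConst ν p κ θ 2).toNNReal, fun u hu => ?_⟩
  · obtain ⟨l, hl⟩ : ∃ l : ℝ≥0, levelConst ν p κ θ 2 * nonlocalSeminorm ν p u = l := by
      lift levelConst ν p κ θ 2 * nonlocalSeminorm ν p u to ℝ≥0 using
        ENNReal.mul_ne_top hL hu.2.ne with l
      exact ⟨l, rfl⟩
    refine ⟨l + 1, by positivity, lt_of_le_of_lt ?_ ENNReal.one_lt_top⟩
    refine modular_le_one_of_levelConst_le hd hp hA hB hC hu.1.1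
      (fun s hs => volume_superlevel_ne_top_of_memLp hp hu.1 hs) le_rfl (by positivity) ?_
    rw [hl]
    exact_mod_cast le_self_add
  · rw [ENNReal.coe_toNNReal hL]
    refine (luxemburgNorm_le_levelConst_mul hd hp hA hB hC hu.1.1
      (fun s hs => volume_superlevel_ne_top_of_memLp hp hu.1 hs) le_rfl).trans ?_
    gcongr
    rw [nonlocalNorm, one_div, ENNReal.le_rpow_inv_iff hp]
    exact le_add_self

end Inequality

theorem rpow_lintegral_le_lintegral_rpow {α : Type*} [MeasurableSpace α] {μ : Measure α}
    [IsProbabilityMeasure μ] {f : α → ℝ≥0∞} (hf : AEMeasurable f μ) {p : ℝ} (hp : 1 ≤ p) :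
    (∫⁻ x, f x ∂μ) ^ p ≤ ∫⁻ x, f x ^ p ∂μ := by
  have h := eLpNorm'_le_eLpNorm'_of_exponent_le one_pos hp μ hf.aestronglyMeasurable
  simp only [eLpNorm', enorm_eq_self, ENNReal.rpow_one, div_one] at h
  rwa [one_div, ENNReal.le_rpow_inv_iff (by linarith)] at h

/-! ### Translation estimates for Sobolev functions. -/

section Translation

variable {d : ℕ}

/-- A smooth compactly supported probability density. -/
structure IsMollifier (ρ : E d → ℝ) : Prop where
  contDiff : ContDiff ℝ ((⊤ : ℕ∞) : WithTop ℕ∞) ρ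
  hasCompactSupport : HasCompactSupport ρ
  nonneg : ∀ x, 0 ≤ ρ x
  integral_eq_one : ∫ x, ρ x = 1

/-- The mollification of `u` by `ρ`. -/
noncomputable def mollify (ρ : E d → ℝ) (u : E d → ℝ) (x : E d) : ℝ := ∫ y, u y * ρ (x - y)

variable {ρ u : E d → ℝ} {g : E d → E d}

theorem mollify_eq_convolution (ρ u : E d → ℝ) :
    mollify ρ u = convolution u ρ (ContinuousLinearMap.mul ℝ ℝ) volume := rfl

theorem IsMollifier.contDiff_mollify (hρ : IsMollifier ρ) (hu : LocallyIntegrable u volume) :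
    ContDiff ℝ 1 (mollify ρ u) := by
  rw [mollify_eq_convolution]
  exact (hρ.hasCompactSupport.contDiff_convolution_right _ hu hρ.contDiff).of_le (by simp)

/-- The weak gradient is tested with `y ↦ ρ (x - y)`; the sign from the reflection cancels the one
from integration by parts. -/
theorem IsMollifier.fderiv_mollify (hρ : IsMollifier ρ) (hug : IsWeakGradient u g) (x v : E d) :
    fderiv ℝ (mollify ρ u) x v = ∫ y, inner ℝ (g y) v * ρ (x - y) := by
  have hu := hug.locallyIntegrable
  have h1 : ContDiff ℝ 1 ρ := hρ.contDiff.of_le (by simp)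
  have hd := (hρ.hasCompactSupport.hasFDerivAt_convolution_right
    (ContinuousLinearMap.mul ℝ ℝ) hu h1 x).fderiv
  rw [mollify_eq_convolution, hd, convolution_precompR_apply _ hu
    (hρ.hasCompactSupport.fderiv ℝ) (h1.continuous_fderiv one_ne_zero)]
  have hψ : ContDiff ℝ ((⊤ : ℕ∞) : WithTop ℕ∞) fun y => ρ (x - y) :=
    hρ.contDiff.comp (contDiff_const.sub contDiff_id)
  have hψc : HasCompactSupport fun y => ρ (x - y) :=
    hρ.hasCompactSupport.comp_homeomorph (Homeomorph.subLeft x)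
  have hweak := hug.integral_eq _ hψ hψc v
  have hder : ∀ y, fderiv ℝ (fun y => ρ (x - y)) y v = -(fderiv ℝ ρ (x - y) v) := by
    intro y
    have h2 : HasFDerivAt (fun y : E d => x - y) (-ContinuousLinearMap.id ℝ (E d)) y := by
      simpa using (hasFDerivAt_id y).const_sub x
    have h3 := ((h1.differentiable one_ne_zero (x - y)).hasFDerivAt.comp y h2).fderiv
    rw [show (fun y => ρ (x - y)) = ρ ∘ fun y => x - y from rfl, h3]
    simp
  simp only [hder, mul_neg, integral_neg, neg_inj] at hweak
  rw [← hweak]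
  rfl

theorem IsMollifier.enorm_fderiv_mollify_le (hρ : IsMollifier ρ) (hug : IsWeakGradient u g)
    (x v : E d) :
    ‖fderiv ℝ (mollify ρ u) x v‖ₑ ≤ ‖v‖ₑ * ∫⁻ z, ENNReal.ofReal (ρ z) * ‖g (x - z)‖ₑ := by
  rw [hρ.fderiv_mollify hug]
  refine (enorm_integral_le_lintegral_enorm _).trans ?_
  rw [← lintegral_sub_left_eq_self (fun y => ‖inner ℝ (g y) v * ρ (x - y)‖ₑ) x,
    ← lintegral_const_mul' _ _ enorm_ne_top]
  refine lintegral_mono fun z => ?_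
  rw [sub_sub_cancel, enorm_mul, Real.enorm_eq_ofReal (hρ.nonneg z)]
  calc ‖inner ℝ (g (x - z)) v‖ₑ * ENNReal.ofReal (ρ z)
      ≤ (‖g (x - z)‖ₑ * ‖v‖ₑ) * ENNReal.ofReal (ρ z) := by
        gcongr
        rw [← ofReal_norm, ← ofReal_norm, ← ofReal_norm,
          ← ENNReal.ofReal_mul (norm_nonneg _)]
        exact ENNReal.ofReal_le_ofReal (norm_inner_le_norm _ _)
    _ = _ := by ring

theorem IsMollifier.enorm_mollify_translate_sub_le (hρ : IsMollifier ρ)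
    (hug : IsWeakGradient u g) (x v : E d) :
    ‖mollify ρ u (x + v) - mollify ρ u x‖ₑ ≤
      ‖v‖ₑ * ∫⁻ s in Ioc (0 : ℝ) 1, ∫⁻ z, ENNReal.ofReal (ρ z) * ‖g (x + s • v - z)‖ₑ := by
  have hc := hρ.contDiff_mollify hug.locallyIntegrable
  have hline : ∀ s : ℝ, HasDerivAt (fun s : ℝ => mollify ρ u (x + s • v))
      (fderiv ℝ (mollify ρ u) (x + s • v) v) s := by
    intro s
    have h1 : HasDerivAt (fun s : ℝ => x + s • v) v s := by
      simpa using ((hasDerivAt_id s).smul_const v).const_add x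
    exact (hc.differentiable one_ne_zero _).hasFDerivAt.comp_hasDerivAt s h1
  have hcont : Continuous fun s : ℝ => fderiv ℝ (mollify ρ u) (x + s • v) v := by
    have := hc.continuous_fderiv one_ne_zero
    fun_prop
  have hint := intervalIntegral.integral_eq_sub_of_hasDerivAt (a := 0) (b := 1)
    (fun s _ => hline s) (hcont.intervalIntegrable 0 1)
  simp only [one_smul, zero_smul, add_zero] at hint
  rw [← hint, intervalIntegral.integral_of_le zero_le_one,
    ← lintegral_const_mul' _ _ enorm_ne_top]
  refine (enorm_integral_le_lintegral_enorm _).trans (lintegral_mono fun s => ?_)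
  exact hρ.enorm_fderiv_mollify_le hug _ _

theorem IsMollifier.isProbabilityMeasure (hρ : IsMollifier ρ) :
    IsProbabilityMeasure (volume.withDensity fun z => ENNReal.ofReal (ρ z)) := by
  refine ⟨?_⟩
  rw [withDensity_apply _ MeasurableSet.univ, Measure.restrict_univ,
    ← ofReal_integral_eq_lintegral_ofReal
      (hρ.contDiff.continuous.integrable_of_hasCompactSupport hρ.hasCompactSupport)
      (Eventually.of_forall hρ.nonneg), hρ.integral_eq_one, ENNReal.ofReal_one]

/-- The difference along the segment is at most `‖v‖` times an average of `‖g‖` over translates,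
with respect to the probability measure `π` on segment parameter and mollifier variable. Jensen
moves the power inside, and translation invariance evaluates the integral in `x`. -/
theorem IsMollifier.lintegral_mollify_translate_sub_le (hρ : IsMollifier ρ)
    (hug : IsWeakGradient u g) {p : ℝ} (hp : 1 ≤ p) (v : E d) :
    ∫⁻ x, ‖mollify ρ u (x + v) - mollify ρ u x‖ₑ ^ p ≤ ‖v‖ₑ ^ p * ∫⁻ x, ‖g x‖ₑ ^ p := by
  have hp0 : 0 ≤ p := by linarith
  have hgm := hug.locallyIntegrable_grad.aestronglyMeasurable
  set G : E d → ℝ≥0∞ := fun x => ‖hgm.mk g x‖ₑ with hG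
  have hGm : Measurable G := hgm.stronglyMeasurable_mk.enorm
  have hGg : (fun x => ‖g x‖ₑ) =ᵐ[volume] G := by
    filter_upwards [hgm.ae_eq_mk] with x hx
    rw [hG, hx]
  have hρm : Measurable fun z => ENNReal.ofReal (ρ z) := by
    have := hρ.contDiff.continuous.measurable
    fun_prop
  have := hρ.isProbabilityMeasure
  set P := volume.withDensity fun z => ENNReal.ofReal (ρ z) with hP
  have : IsProbabilityMeasure (volume.restrict (Ioc (0 : ℝ) 1)) := ⟨by simp⟩
  set π := (volume.restrict (Ioc (0 : ℝ) 1)).prod P with hπ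
  have hpt : ∀ x, ‖mollify ρ u (x + v) - mollify ρ u x‖ₑ ^ p ≤
      ‖v‖ₑ ^ p * ∫⁻ w, G (x + (w.1 • v - w.2)) ^ p ∂π := by
    intro x
    have h1 : ∫⁻ s in Ioc (0 : ℝ) 1, ∫⁻ z, ENNReal.ofReal (ρ z) * ‖g (x + s • v - z)‖ₑ =
        ∫⁻ w, G (x + (w.1 • v - w.2)) ∂π := by
      rw [hπ, lintegral_prod _ (by fun_prop)]
      refine lintegral_congr fun s => ?_
      rw [hP, lintegral_withDensity_eq_lintegral_mul _ hρm (by fun_prop)]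
      refine lintegral_congr_ae ?_
      have := (Measure.measurePreserving_sub_left volume (x + s • v)).quasiMeasurePreserving.ae_eq hGg
      filter_upwards [this] with z hz
      rw [Pi.mul_apply, ← add_sub_assoc]
      exact congrArg _ hz
    calc ‖mollify ρ u (x + v) - mollify ρ u x‖ₑ ^ p
        ≤ (‖v‖ₑ * ∫⁻ w, G (x + (w.1 • v - w.2)) ∂π) ^ p := by
          rw [← h1]
          gcongr
          exact hρ.enorm_mollify_translate_sub_le hug x v
      _ ≤ ‖v‖ₑ ^ p * ∫⁻ w, G (x + (w.1 • v - w.2)) ^ p ∂π := by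
          rw [ENNReal.mul_rpow_of_nonneg _ _ hp0]
          gcongr
          exact rpow_lintegral_le_lintegral_rpow (by fun_prop) hp
  calc ∫⁻ x, ‖mollify ρ u (x + v) - mollify ρ u x‖ₑ ^ p
      ≤ ∫⁻ x, ‖v‖ₑ ^ p * ∫⁻ w, G (x + (w.1 • v - w.2)) ^ p ∂π := lintegral_mono hpt
    _ = ‖v‖ₑ ^ p * ∫⁻ x, ∫⁻ w, G (x + (w.1 • v - w.2)) ^ p ∂π :=
        lintegral_const_mul' _ _ (ENNReal.rpow_ne_top_of_nonneg hp0 enorm_ne_top)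
    _ = ‖v‖ₑ ^ p * ∫⁻ w, ∫⁻ x, G (x + (w.1 • v - w.2)) ^ p ∂volume ∂π := by
        rw [lintegral_lintegral_swap (by fun_prop)]
    _ = ‖v‖ₑ ^ p * ∫⁻ x, G x ^ p := by
        congr 1
        simp_rw [fun w : ℝ × E d =>
          lintegral_add_right_eq_self (μ := volume) (fun x => G x ^ p) (w.1 • v - w.2)]
        simp
    _ = ‖v‖ₑ ^ p * ∫⁻ x, ‖g x‖ₑ ^ p := by
        congr 1
        refine lintegral_congr_ae ?_
        filter_upwards [hGg] with x hx
        rw [← hx]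

theorem exists_mollifier_seq (hu : LocallyIntegrable u volume) :
    ∃ ρ : ℕ → E d → ℝ, (∀ n, IsMollifier (ρ n)) ∧
      ∀ᵐ x, Tendsto (fun n => mollify (ρ n) u x) atTop (𝓝 (u x)) := by
  let φ : ℕ → ContDiffBump (0 : E d) := fun n =>
    ⟨1 / ((n : ℝ) + 1), 2 * (1 / ((n : ℝ) + 1)), by positivity, by
      have : (0 : ℝ) < 1 / ((n : ℝ) + 1) := by positivity
      linarith⟩
  refine ⟨fun n => (φ n).normed volume, fun n => ⟨(φ n).contDiff_normed,
    (φ n).hasCompactSupport_normed, (φ n).nonneg_normed, (φ n).integral_normed⟩, ?_⟩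
  have hlim : Tendsto (fun n => (φ n).rOut) atTop (𝓝 0) := by
    have := (tendsto_one_div_add_atTop_nhds_zero_nat (𝕜 := ℝ)).const_mul 2
    rwa [mul_zero] at this
  filter_upwards [ContDiffBump.ae_convolution_tendsto_right_of_locallyIntegrable (K := 2) hlim
    (Eventually.of_forall fun n => le_rfl) hu] with x hx
  refine hx.congr fun n => ?_
  rw [convolution_lsmul_swap, mollify]
  exact integral_congr_ae (Eventually.of_forall fun y => by simp [mul_comm])

/-- The bound for mollifications does not depend on the mollifier, so almost everywhere convergence
and Fatou suffice. -/
theorem IsWeakGradient.lintegral_translate_sub_le (hug : IsWeakGradient u g) {p : ℝ}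
    (hp : 1 ≤ p) (v : E d) :
    ∫⁻ x, ‖u (x + v) - u x‖ₑ ^ p ≤ ‖v‖ₑ ^ p * ∫⁻ x, ‖g x‖ₑ ^ p := by
  obtain ⟨ρ, hρ, hlim⟩ := exists_mollifier_seq hug.locallyIntegrable
  have hlim' := (measurePreserving_add_right volume v).quasiMeasurePreserving.ae hlim
  calc ∫⁻ x, ‖u (x + v) - u x‖ₑ ^ p
      = ∫⁻ x, liminf (fun n => ‖mollify (ρ n) u (x + v) - mollify (ρ n) u x‖ₑ ^ p) atTop := by
        refine lintegral_congr_ae ?_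
        filter_upwards [hlim, hlim'] with x hx hx'
        refine (Tendsto.liminf_eq ?_).symm
        exact (ENNReal.continuous_rpow_const.tendsto _).comp
          ((continuous_enorm.tendsto _).comp (hx'.sub hx))
    _ ≤ liminf (fun n => ∫⁻ x, ‖mollify (ρ n) u (x + v) - mollify (ρ n) u x‖ₑ ^ p) atTop := by
        refine lintegral_liminf_le fun n => ?_
        have := ((hρ n).contDiff_mollify hug.locallyIntegrable).continuous.measurable
        fun_prop
    _ ≤ ‖v‖ₑ ^ p * ∫⁻ x, ‖g x‖ₑ ^ p := by
        refine (liminf_le_liminf (Eventually.of_forall fun n =>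
          (hρ n).lintegral_mollify_translate_sub_le hug hp v)).trans ?_
        simp

theorem lintegral_translate_sub_le_lintegral (hu : AEStronglyMeasurable u volume) {p : ℝ}
    (hp : 1 ≤ p) (v : E d) :
    ∫⁻ x, ‖u (x + v) - u x‖ₑ ^ p ≤ 2 ^ p * ∫⁻ x, ‖u x‖ₑ ^ p := by
  have hp0 : 0 ≤ p := by linarith
  calc ∫⁻ x, ‖u (x + v) - u x‖ₑ ^ p
      ≤ ∫⁻ x, 2 ^ (p - 1) * (‖u (x + v)‖ₑ ^ p + ‖u x‖ₑ ^ p) := by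
        refine lintegral_mono fun x => ?_
        refine le_trans ?_ (ENNReal.rpow_add_le_mul_rpow_add_rpow _ _ hp)
        gcongr
        exact enorm_sub_le
    _ = 2 ^ (p - 1) * (2 * ∫⁻ x, ‖u x‖ₑ ^ p) := by
        rw [lintegral_const_mul' _ _ (ENNReal.rpow_ne_top_of_nonneg (by linarith) (by simp)),
          lintegral_add_right' _ (hu.enorm.pow_const p),
          lintegral_add_right_eq_self (fun x => ‖u x‖ₑ ^ p), two_mul]
    _ = 2 ^ p * ∫⁻ x, ‖u x‖ₑ ^ p := by
        rw [← mul_assoc]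
        nth_rw 2 [← ENNReal.rpow_one 2]
        rw [← ENNReal.rpow_add _ _ two_ne_zero (by simp), sub_add_cancel]

end Translation

/-! ### The embedding of `W^{1,p}` into `W^p_ν`. -/

section Embedding

variable {d : ℕ} {ν : E d → ℝ≥0∞} {p κ θ : ℝ}

/-- After substituting `h = x - y` and applying Tonelli, the inner integral is an `L^p` translation
difference: the gradient bound controls it for small `h`, the trivial bound for large `h`, which
produces the weight `min 1 (‖h‖^p)`. -/
theorem lintegral_difference_le_of_isWeakGradient (hp : 1 ≤ p) (hν : Measurable ν)
    {u : E d → ℝ} {g : E d → E d} (hug : IsWeakGradient u g) :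
    ∫⁻ x, ∫⁻ y, ‖u x - u y‖ₑ ^ p * ν (x - y) ≤
      (2 ^ p * ∫⁻ h, min 1 (‖h‖ₑ ^ p) * ν h) * (∫⁻ x, ‖u x‖ₑ ^ p + ‖g x‖ₑ ^ p) := by
  have hp0 : 0 ≤ p := by linarith
  have hum := hug.locallyIntegrable.aestronglyMeasurable
  have hgm := hug.locallyIntegrable_grad.aestronglyMeasurable
  have h2 : (1 : ℝ≥0∞) ≤ 2 ^ p := ENNReal.one_le_rpow (by norm_num) (by linarith)
  set N := ∫⁻ x, ‖u x‖ₑ ^ p + ‖g x‖ₑ ^ p with hN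
  have hNu : ∫⁻ x, ‖u x‖ₑ ^ p ≤ N := lintegral_mono fun x => le_self_add
  have hNg : ∫⁻ x, ‖g x‖ₑ ^ p ≤ N := lintegral_mono fun x => le_add_self
  set w := hum.mk u with hw
  have hwm : Measurable w := hum.stronglyMeasurable_mk.measurable
  have huw : u =ᵐ[volume] w := hum.ae_eq_mk
  have htrans : ∀ h, ∫⁻ x, ‖w x - w (x - h)‖ₑ ^ p ≤ 2 ^ p * min 1 (‖h‖ₑ ^ p) * N := by
    intro h
    have e : ∫⁻ x, ‖w x - w (x - h)‖ₑ ^ p = ∫⁻ x, ‖u (x + -h) - u x‖ₑ ^ p := by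
      refine lintegral_congr_ae ?_
      have h' := (measurePreserving_add_right volume (-h)).quasiMeasurePreserving.ae_eq huw
      filter_upwards [huw, h'] with x hx hx'
      simp only [Function.comp_apply] at hx'
      rw [hx, hx', ← sub_eq_add_neg, ← enorm_neg, neg_sub]
    rw [e, mul_assoc, min_mul_of_nonneg _ _ (zero_le), mul_min_of_nonneg _ _ (zero_le), one_mul]
    refine le_min ?_ ?_
    · exact (lintegral_translate_sub_le_lintegral hum hp _).trans (by gcongr)
    · refine (hug.lintegral_translate_sub_le hp _).trans ?_
      rw [enorm_neg, ← mul_assoc]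
      gcongr
      exact le_mul_of_one_le_left (zero_le) h2
  rw [lintegral_difference_congr huw]
  calc ∫⁻ x, ∫⁻ y, ‖w x - w y‖ₑ ^ p * ν (x - y)
      = ∫⁻ x, ∫⁻ h, ‖w x - w (x - h)‖ₑ ^ p * ν h := by
        refine lintegral_congr fun x => ?_
        rw [← lintegral_sub_left_eq_self (fun y => ‖w x - w y‖ₑ ^ p * ν (x - y)) x]
        simp
    _ = ∫⁻ h, ∫⁻ x, ‖w x - w (x - h)‖ₑ ^ p * ν h := lintegral_lintegral_swap (by fun_prop)
    _ = ∫⁻ h, (∫⁻ x, ‖w x - w (x - h)‖ₑ ^ p) * ν h := by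
        refine lintegral_congr fun h => lintegral_mul_const _ (by fun_prop)
    _ ≤ ∫⁻ h, (2 ^ p * N) * (min 1 (‖h‖ₑ ^ p) * ν h) := by
        refine lintegral_mono fun h => ?_
        calc _ ≤ 2 ^ p * min 1 (‖h‖ₑ ^ p) * N * ν h := by gcongr; exact htrans h
          _ = _ := by ring
    _ = (2 ^ p * ∫⁻ h, min 1 (‖h‖ₑ ^ p) * ν h) * N := by
        rw [lintegral_const_mul _ (by fun_prop)]; ring

theorem eLpNorm_ofReal_rpow {F : Type*} [NormedAddCommGroup F] (hp : 0 < p) (f : E d → F) :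
    eLpNorm f (ENNReal.ofReal p) volume ^ p = ∫⁻ x, ‖f x‖ₑ ^ p := by
  rw [eLpNorm_eq_lintegral_rpow_enorm_toReal (by simpa using hp) ENNReal.ofReal_ne_top,
    ENNReal.toReal_ofReal hp.le, one_div, ENNReal.rpow_inv_rpow hp.ne']

theorem nonlocalSeminorm_rpow (hp : 0 < p) (u : E d → ℝ) :
    nonlocalSeminorm ν p u ^ p = ∫⁻ x, ∫⁻ y, ‖u x - u y‖ₑ ^ p * ν (x - y) := by
  rw [nonlocalSeminorm, one_div, ENNReal.rpow_inv_rpow hp.ne']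

theorem exists_nonlocalSeminorm_rpow_le (hp : 1 ≤ p) (hA : IsAlmostDecreasingLevyKernel ν p κ) :
    ∃ K : ℝ≥0, 0 < K ∧ ∀ (u : E d → ℝ) (g : E d → E d), IsWeakGradient u g →
      nonlocalSeminorm ν p u ^ p ≤ K * (eLpNorm u (ENNReal.ofReal p) volume ^ p +
        eLpNorm g (ENNReal.ofReal p) volume ^ p) := by
  have hp0 : 0 < p := by linarith
  have hfin : 2 ^ p * ∫⁻ h, min 1 (‖h‖ₑ ^ p) * ν h ≠ ∞ :=
    ENNReal.mul_ne_top (ENNReal.rpow_ne_top_of_nonneg hp0.le (by simp)) hA.levy.ne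
  refine ⟨(2 ^ p * ∫⁻ h, min 1 (‖h‖ₑ ^ p) * ν h).toNNReal + 1, by positivity, fun u g hug => ?_⟩
  rw [nonlocalSeminorm_rpow hp0, eLpNorm_ofReal_rpow hp0, eLpNorm_ofReal_rpow hp0,
    ← lintegral_add_left' (hug.locallyIntegrable.aestronglyMeasurable.enorm.pow_const p)]
  refine (lintegral_difference_le_of_isWeakGradient hp hA.measurable hug).trans ?_
  gcongr
  rw [ENNReal.coe_add, ENNReal.coe_toNNReal hfin]
  exact le_self_add

theorem continuouslyEmbeds_sobolevSpace_nonlocalSpace (hp : 1 ≤ p)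
    (hA : IsAlmostDecreasingLevyKernel ν p κ) :
    ContinuouslyEmbeds (sobolevSpace d p) (sobolevNorm p) (nonlocalSpace ν p)
      (nonlocalNorm ν p) := by
  have hp0 : 0 < p := by linarith
  obtain ⟨K, hK, hbound⟩ := exists_nonlocalSeminorm_rpow_le hp hA
  have hK0 : (K : ℝ≥0∞) ≠ 0 := by exact_mod_cast hK.ne'
  refine ⟨fun u ⟨hu, g, hug, hg⟩ => ⟨hu, ?_⟩, (1 + K) ^ (1 / p), fun u ⟨hu, _⟩ => ?_⟩
  · have h := hbound u g hug
    rw [← ENNReal.rpow_lt_top_iff_of_pos hp0]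
    refine h.trans_lt (ENNReal.mul_lt_top ENNReal.coe_lt_top (ENNReal.add_lt_top.2 ⟨?_, ?_⟩))
    · exact ENNReal.rpow_lt_top_of_nonneg hp0.le hu.2.ne
    · exact ENNReal.rpow_lt_top_of_nonneg hp0.le hg.2.ne
  · have hgrad : nonlocalSeminorm ν p u ^ p ≤
        K * (eLpNorm u (ENNReal.ofReal p) volume ^ p + gradNorm p u ^ p) := by
      -- As `gradNorm` is an infimum, the inequality is solved for it, so that it can be checked for
      -- each weak gradient; the division is why `K` is chosen positive.
      rw [mul_comm, ← ENNReal.div_le_iff_le_mul (.inl hK0) (.inl ENNReal.coe_ne_top),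
        ← tsub_le_iff_left, ← ENNReal.rpow_inv_le_iff hp0]
      refine le_iInf₂ fun g hug => ?_
      rw [ENNReal.rpow_inv_le_iff hp0, tsub_le_iff_left,
        ENNReal.div_le_iff_le_mul (.inl hK0) (.inl ENNReal.coe_ne_top), mul_comm]
      exact hbound u g hug
    rw [nonlocalNorm, sobolevNorm, ENNReal.coe_rpow_of_nonneg _ (by positivity),
      ← ENNReal.mul_rpow_of_nonneg _ _ (by positivity)]
    gcongr
    rw [ENNReal.coe_add, ENNReal.coe_one, add_mul, one_mul]
    gcongr
    exact le_self_add

theorem ContinuouslyEmbeds.trans {X Y Z : Set (E d → ℝ)} {nX nY nZ : (E d → ℝ) → ℝ≥0∞}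
    (h₁ : ContinuouslyEmbeds X nX Y nY) (h₂ : ContinuouslyEmbeds Y nY Z nZ) :
    ContinuouslyEmbeds X nX Z nZ := by
  obtain ⟨hs₁, C₁, hC₁⟩ := h₁
  obtain ⟨hs₂, C₂, hC₂⟩ := h₂
  refine ⟨hs₁.trans hs₂, C₂ * C₁, fun u hu => ?_⟩
  calc nZ u ≤ C₂ * nY u := hC₂ u (hs₁ hu)
    _ ≤ C₂ * (C₁ * nX u) := by gcongr; exact hC₁ u hu
    _ = ((C₂ * C₁ : ℝ≥0) : ℝ≥0∞) * nX u := by rw [ENNReal.coe_mul, mul_assoc]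

end Embedding

end NonlocalSobolev

theorem theorem1p1 (d : ℕ) (hd : 1 ≤ d) (p : ℝ) (hp : 1 ≤ p) (ν : E d → ℝ≥0∞) (κ θ : ℝ)
    (hA : IsAlmostDecreasingLevyKernel ν p κ)
    (hB : HasCriticalYoung ν p)
    (hC : GrowthCondition (criticalFun ν p) p θ) :
    (∀ t : ℝ, 2 ≤ t → ∀ u ∈ orliczSpace d (criticalFun ν p),
      luxemburgNorm (criticalFun ν p) u ≤
        Theta (criticalFun ν p) p κ θ t * nonlocalSeminorm ν p u) ∧
    ContinuouslyEmbeds (nonlocalSpace ν p) (nonlocalNorm ν p)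
      (orliczSpace d (criticalFun ν p)) (luxemburgNorm (criticalFun ν p)) ∧
    ContinuouslyEmbeds (sobolevSpace d p) (sobolevNorm p)
      (orliczSpace d (criticalFun ν p)) (luxemburgNorm (criticalFun ν p)) := by
  have hp0 : 0 < p := by linarith
  have hW := continuouslyEmbeds_nonlocalSpace hd hp0 hA hB hC
  refine ⟨fun t ht u hu => ?_, hW, (continuouslyEmbeds_sobolevSpace_nonlocalSpace hp hA).trans hW⟩
  calc luxemburgNorm (criticalFun ν p) u ≤ levelConst ν p κ θ t * nonlocalSeminorm ν p u :=
        luxemburgNorm_le_levelConst_mul hd hp0 hA hB hC hu.1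
          (fun s hs => volume_superlevel_ne_top_of_mem_orliczSpace hd hp0 hB hu hs) ht
    _ ≤ Theta (criticalFun ν p) p κ θ t * nonlocalSeminorm ν p u := by
        gcongr
        exact levelConst_le_Theta hp hA.kappa_pos hA.kappa_le_one ht
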